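/- **Theorem 1** (one-sided Rubio de Francia inequality for bounded Vilenkin systems). Let $(p_i)_{i\ge 1}$ be a bounded sequence of integers, $2\le p_i\le M$, and put $m_0=1$, $m_k=p_1\cdots p_k$. For $k\ge 1$ let $r_k$ be the function on $[0,1]$ obtained by cutting each of the $m_{k-1}$ equal parts of $[0,1]$ into $p_k$ equal segments and setting $r_k=e^{2\pi i j/p_k}$ on the $j$-th of these segments, $j=0,\dots,p_k-1$ (the values at end points are immaterial). For an integer $n\ge 0$ with mixed radix representation $n=\sum_{k\ge1}\alpha_k m_{k-1}$, $0\le\alpha_k\le p_k-1$, let $w_n=\prod_{k\ge1} r_k^{\alpha_k}$ be the corresponding Vilenkin function, and for $f\in L^1[0,1]$ let $\widehat f(n)=\int_0^1 f\,\overline{w_n}$. Let $1<p\le 2$. Then there is a constant $C>0$, depending only on $p$ and the sequence $(p_i)$, such that the following holds. Let $\{I_s\}$ be a finite or countable family of pairwise disjoint finite intervals $I_s=[a_s,b_s)$ in $\mathbb Z_+=\{0,1,2,\dots\}$ and let $f_s\in L^1[0,1]$ be complex-valued functions with $\widehat f_s(n)=0$ for all $n\notin I_s$. Then $$ \Big\|\sum_s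 f_s\Big\|_{L^p[0,1]}\le C\,\Big\|\Big(\sum_s|f_s|^2\Big)^{1/2}\Big\|_{L^p[0,1]}, $$ where, whenever the right-hand side is finite, the series $\sum_s f_s$ converges unconditionally in $L^p[0,1]$ (if the right-hand side is infinite, the inequality is void). -/

import Mathlib

open MeasureTheory Filter Topology
open scoped ENNReal NNReal

noncomputable section

namespace Vilenkin

/-- The partial products `m_k = p_1 p_2 ⋯ p_k`, with `m_0 = 1`. The sequence is indexed from `0`
here: `q k` stands for `p_{k+1}`. -/
def radix (q : ℕ → ℕ) (k : ℕ) : ℕ := ∏ i ∈ Finset.range k, q i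

/-- The coefficient of `m_k` in the mixed radix representation `n = ∑ k, digit q n k * m_k`,
`0 ≤ digit q n k < q k`. -/
def digit (q : ℕ → ℕ) (n k : ℕ) : ℕ := n / radix q k % q k

/-- The generalized Rademacher function `r_{k+1}`: each of the `m_k` equal parts of the unit
interval is cut into `q k` equal segments, and the function is `exp (2 π i j / q k)` on the `j`-th
of them, `j = 0, …, q k - 1`. (The values at the finitely many end points do not matter.) -/
def rademacher (q : ℕ → ℕ) (k : ℕ) (x : ℝ) : ℂ :=
  Complex.exp (2 * Real.pi * Complex.I *
    ((⌊x * (radix q (k + 1) : ℝ)⌋₊ % q k : ℕ) : ℂ) / (q k : ℂ))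

/-- The Vilenkin function `w_n`, the product of the `r_{k+1}` to the power `digit q n k`.
As `q i ≥ 2`, one has `n < 2 ^ n ≤ m_n`, so that all digits with index `k ≥ n` vanish. -/
def vilenkin (q : ℕ → ℕ) (n : ℕ) (x : ℝ) : ℂ :=
  ∏ k ∈ Finset.range n, rademacher q k x ^ digit q n k

/-- Lebesgue measure on the unit interval. -/
def unitMeasure : Measure ℝ := volume.restrict (Set.Icc 0 1)

/-- The Vilenkin–Fourier coefficient `∫ f * conj w_n` over the unit interval. -/
def coeff (q : ℕ → ℕ) (f : ℝ → ℂ) (n : ℕ) : ℂ :=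
  ∫ x, f x * (starRingEnd ℂ) (vilenkin q n x) ∂unitMeasure

/-- The pointwise `ℓ²` norm `(∑ |f_s x|²)^(1/2)` of a family of functions, as an extended
nonnegative real (it may be infinite). -/
def squareFunction {ι : Type*} (f : ι → ℝ → ℂ) (x : ℝ) : ℝ≥0∞ :=
  (∑' s, ‖f s x‖ₑ ^ 2) ^ (1 / 2 : ℝ)

end Vilenkin

end

/-!
The inequality is dual to Rubio de Francia's inequality
`‖(∑ |P_s g|²)^(1/2)‖_Q ≤ C ‖g‖_Q` for the conjugate exponent `Q ≥ 2`, where `P_s` is the projection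
onto the frequencies in `I_s`: one pairs `F = ∑ f_s` with `g = |F|^(p-2) F`
(`exists_finite_rubio_de_francia`). A function with spectrum in a finite interval is a Vilenkin
polynomial, so for finitely many `f_s` everything lives on the finite group of the first `N` digits,
where the Vilenkin functions are the characters and the cells of length `1 / m_k` form a filtration.

For `Q ≥ 2` the square function is bounded in two steps.

* *Blocks.* If every `I_s` is a block `{n | n / m_k = j}`, then `|P_s g|²` depends on the first `k`
  digits only, and Bessel's inequality holds on each cell of level `k` for blocks of length at least
  `m_k`. Thus the partial sums of `∑ |P_s g|²`, ordered by scale, form an increasing adapted process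
  whose conditional increments are dominated by `|g|²`, and the Garsia–Neveu inequality bounds it
  in `L^(Q/2)` (`exists_block_square`).
* *Intervals.* Apart from `{a}`, the maximal blocks inside `(a, b)` share their parent block with `a` or
  with `b`. After multiplication by the conjugate of `w_a`, respectively `w_b`, the sum of the blocks
  of scale `k` on one side is a martingale difference, so Burkholder's inequality for `ℓ²`-valued
  martingales (`exists_burkholder`) replaces `P_s g` by its square function. There are at most
  `M` blocks of each scale on each side, which reduces matters to blocks
  (`exists_modulated_square`, `exists_interval_square`). This is where boundedness of `q` enters.

Conditional expectations are avoided throughout: a statement about the conditional expectation at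
time `k` is expressed by testing against functions that are constant on the cells of level `k`.
The norm inequalities are homogeneous, so that sums over the finite group replace integrals.
Finally `exists_tendsto_of_finite` passes from finite to countable families.
-/

namespace Vilenkin

/-! ### Martingale inequalities on a finite set -/

/-- Bernoulli's inequality in homogeneous form: the graph of `t ↦ t ^ r` lies above its tangent
at `b`. -/
lemma rpow_tangent_le {r : ℝ} (hr : 1 ≤ r) {a b : ℝ} (ha : 0 ≤ a) (hb : 0 ≤ b) :
    b ^ r + r * b ^ (r - 1) * (a - b) ≤ a ^ r := by
  rcases hb.eq_or_lt with rfl | hb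
  · rcases hr.eq_or_lt with rfl | hr
    · simp
    · rw [Real.zero_rpow (by linarith), Real.zero_rpow (by linarith)]
      simpa using Real.rpow_nonneg ha r
  · have h := one_add_mul_self_le_rpow_one_add (s := a / b - 1)
      (by have := div_nonneg ha hb.le; linarith) hr
    rw [show 1 + (a / b - 1) = a / b by ring, Real.div_rpow ha hb.le,
      le_div_iff₀ (Real.rpow_pos_of_pos hb r)] at h
    have h2 : b ^ r = b ^ (r - 1) * b := by
      rw [← Real.rpow_add_one hb.ne']; congr 1; ring
    calc b ^ r + r * b ^ (r - 1) * (a - b) = (1 + r * (a / b - 1)) * b ^ r := by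
          rw [h2]; field_simp
      _ ≤ a ^ r := h

/-- A self-improving form of Hölder's inequality: if `X ≤ C ∑ U ^ α V ^ (1 - α)` and `∑ U` is
itself controlled by `X`, then `X` is controlled by `∑ V`. Using Young's inequality instead of
dividing by a power of `X` makes the case `α = 0` and the case `X = 0` harmless. -/
lemma exists_le_of_holder {α K C : ℝ} (hα : 0 ≤ α) (hα1 : α < 1) (hK : 0 ≤ K) (hC : 0 ≤ C) :
    ∃ C' : ℝ, 0 ≤ C' ∧ ∀ {Ω : Type} [Fintype Ω] (U V : Ω → ℝ) (X : ℝ), (∀ x, 0 ≤ U x) →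
      (∀ x, 0 ≤ V x) → ∑ x, U x ≤ K * X → X ≤ C * ∑ x, U x ^ α * V x ^ (1 - α) →
      X ≤ C' * ∑ x, V x := by
  set ε : ℝ := 1 / (2 * (C * K + 1)) with hε
  have hCK : 0 ≤ C * K := mul_nonneg hC hK
  have hε0 : 0 < ε := by positivity
  set D : ℝ := ε ^ (-α / (1 - α)) with hD
  have hD0 : 0 < D := Real.rpow_pos_of_pos hε0 _
  have hprod : ε ^ α * D ^ (1 - α) = 1 := by
    rw [hD, ← Real.rpow_mul hε0.le, ← Real.rpow_add hε0]
    rw [div_mul_cancel₀ _ (by linarith : (1 - α) ≠ 0)]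
    simp
  refine ⟨2 * C * D, by positivity, ?_⟩
  intro Ω _ U V X hU hV hUX hX
  have hVs : 0 ≤ ∑ x, V x := Finset.sum_nonneg fun x _ => hV x
  have hUs : 0 ≤ ∑ x, U x := Finset.sum_nonneg fun x _ => hU x
  have hpt : ∀ x, U x ^ α * V x ^ (1 - α) ≤ ε * U x + D * V x := by
    intro x
    have h := Real.geom_mean_le_arith_mean2_weighted hα (by linarith : 0 ≤ 1 - α)
      (mul_nonneg hε0.le (hU x)) (mul_nonneg hD0.le (hV x)) (by ring)
    rw [Real.mul_rpow hε0.le (hU x), Real.mul_rpow hD0.le (hV x)] at h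
    calc U x ^ α * V x ^ (1 - α)
        = (ε ^ α * D ^ (1 - α)) * (U x ^ α * V x ^ (1 - α)) := by rw [hprod, one_mul]
      _ = ε ^ α * U x ^ α * (D ^ (1 - α) * V x ^ (1 - α)) := by ring
      _ ≤ α * (ε * U x) + (1 - α) * (D * V x) := h
      _ ≤ 1 * (ε * U x) + 1 * (D * V x) := by
          have h1 := mul_nonneg hε0.le (hU x)
          have h2 := mul_nonneg hD0.le (hV x)
          gcongr
          linarith
      _ = _ := by ring
  have hsum : ∑ x, U x ^ α * V x ^ (1 - α) ≤ ε * ∑ x, U x + D * ∑ x, V x := by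
    rw [Finset.mul_sum, Finset.mul_sum, ← Finset.sum_add_distrib]
    exact Finset.sum_le_sum fun x _ => hpt x
  by_cases hX0 : X ≤ 0
  · exact hX0.trans (by positivity)
  push Not at hX0
  have h1 : X ≤ C * (ε * (K * X) + D * ∑ x, V x) :=
    hX.trans (mul_le_mul_of_nonneg_left (hsum.trans (by gcongr)) hC)
  have h2 : C * K * ε ≤ 1 / 2 := by
    rw [hε, mul_one_div, div_le_div_iff₀ (by positivity) (by norm_num)]
    linarith
  nlinarith

/-- `φ` is constant on the classes of `e`: the finite version of measurability with respect to the
`σ`-algebra whose atoms are the classes of `e`. -/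
def ConstOn {Ω β : Type*} (e : Setoid Ω) (φ : Ω → β) : Prop := ∀ ⦃x y⦄, e x y → φ x = φ y

lemma ConstOn.mono {Ω β : Type*} {e e' : Setoid Ω} (h : e ≤ e') {φ : Ω → β} (hφ : ConstOn e' φ) :
    ConstOn e φ := fun _ _ hxy => hφ (h hxy)

lemma ConstOn.sum {Ω β ι : Type*} [AddCommMonoid β] {e : Setoid Ω} {s : Finset ι}
    {φ : ι → Ω → β} (hφ : ∀ i ∈ s, ConstOn e (φ i)) : ConstOn e fun x => ∑ i ∈ s, φ i x :=
  fun _ _ hxy => Finset.sum_congr rfl fun i hi => hφ i hi hxy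

section Martingale

variable {Ω : Type} [Fintype Ω] {𝓕 : ℕ → Setoid Ω}

/-- The Garsia–Neveu inequality for an increasing process with increments `a k`, which jumps at
time `k` by a quantity known at time `k`. The hypothesis says that the conditional expectation at
time `k` of the increment from `k` (included) onwards is at most that of `Y`. -/
lemma garsia_aux (h𝓕 : Antitone 𝓕) {r : ℝ} (hr : 1 ≤ r) (n : ℕ) (a : ℕ → Ω → ℝ) (Y : Ω → ℝ)
    (ha0 : ∀ k x, 0 ≤ a k x) (ha : ∀ k, ConstOn (𝓕 k) (a k))
    (hY : ∀ x, 0 ≤ Y x)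
    (h : ∀ k < n, ∀ φ : Ω → ℝ, (∀ x, 0 ≤ φ x) → ConstOn (𝓕 k) φ →
      ∑ x, φ x * ∑ j ∈ Finset.Ico k n, a j x ≤ ∑ x, φ x * Y x) :
    ∑ x, (∑ k ∈ Finset.range n, a k x) ^ r ≤
      r * ∑ x, Y x * (∑ k ∈ Finset.range n, a k x) ^ (r - 1) := by
  rcases n.eq_zero_or_pos with rfl | hn
  · simp only [Finset.range_zero, Finset.sum_empty, Real.zero_rpow (by linarith : r ≠ 0),
      Finset.sum_const_zero]
    exact mul_nonneg (by linarith) (Finset.sum_nonneg fun x _ =>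
      mul_nonneg (hY x) (Real.rpow_nonneg le_rfl _))
  set A : ℕ → Ω → ℝ := fun k x => ∑ j ∈ Finset.range k, a j x with hA
  -- For `r = 1` the power `A 0 ^ (r - 1)` would be `1`; the integrand has to start from `0`.
  set B : ℕ → Ω → ℝ := fun k x => if k = 0 then 0 else A k x ^ (r - 1) with hB
  have hA0 : ∀ k x, 0 ≤ A k x := fun k x => Finset.sum_nonneg fun j _ => ha0 j x
  have hAsucc : ∀ k x, A (k + 1) x = A k x + a k x := fun k x => Finset.sum_range_succ _ _
  have hBmono : ∀ k x, B k x ≤ B (k + 1) x := by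
    intro k x
    simp only [hB, Nat.succ_ne_zero, if_false]
    split_ifs
    · exact Real.rpow_nonneg (hA0 _ _) _
    · exact Real.rpow_le_rpow (hA0 _ _) (by rw [hAsucc]; linarith [ha0 k x]) (by linarith)
  have hAmeas : ∀ k, ConstOn (𝓕 k) (A (k + 1)) := fun k => ConstOn.sum fun j hj =>
    (ha j).mono (h𝓕 (Nat.lt_succ_iff.1 (Finset.mem_range.1 hj)))
  have hBmeas : ∀ k, ConstOn (𝓕 k) (B (k + 1)) := fun k x y hxy => by
    simp only [hB]; rw [hAmeas k hxy]
  have hBmeas' : ∀ k, ConstOn (𝓕 k) (B k) := by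
    intro k
    cases k with
    | zero => intro x y _; simp [hB]
    | succ k => exact (hBmeas k).mono (h𝓕 (Nat.le_succ k))
  have hpow : ∀ m x, A m x ^ r ≤ r * ∑ k ∈ Finset.range m, a k x * B (k + 1) x := by
    intro m x
    induction m with
    | zero => simp [hA, Real.zero_rpow (by linarith : r ≠ 0)]
    | succ m ih =>
      rw [Finset.sum_range_succ]
      have h1 := rpow_tangent_le hr (hA0 m x) (hA0 (m + 1) x)
      have h2 : B (m + 1) x = A (m + 1) x ^ (r - 1) := by simp [hB]
      have h3 : A m x - A (m + 1) x = - a m x := by rw [hAsucc]; ring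
      rw [h3] at h1
      rw [h2]
      linarith
  have habel : ∀ m x, ∑ k ∈ Finset.range m, a k x * B (k + 1) x =
      ∑ k ∈ Finset.range m, (B (k + 1) x - B k x) * ∑ j ∈ Finset.Ico k m, a j x := by
    intro m x
    induction m with
    | zero => simp
    | succ m ih =>
      rw [Finset.sum_range_succ, ih, Finset.sum_range_succ (n := m)]
      have : ∀ k ∈ Finset.range m, (B (k + 1) x - B k x) * ∑ j ∈ Finset.Ico k (m + 1), a j x =
          (B (k + 1) x - B k x) * ∑ j ∈ Finset.Ico k m, a j x +
            (B (k + 1) x - B k x) * a m x := by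
        intro k hk
        rw [Finset.sum_Ico_succ_top (Finset.mem_range.1 hk).le, mul_add]
      rw [Finset.sum_congr rfl this, Finset.sum_add_distrib, ← Finset.sum_mul,
        Finset.sum_range_sub (fun k => B k x)]
      have h0 : B 0 x = 0 := by simp [hB]
      rw [h0]
      simp
      ring
  calc ∑ x, A n x ^ r ≤ ∑ x, r * ∑ k ∈ Finset.range n, a k x * B (k + 1) x :=
        Finset.sum_le_sum fun x _ => hpow n x
    _ = r * ∑ k ∈ Finset.range n, ∑ x, (B (k + 1) x - B k x) * ∑ j ∈ Finset.Ico k n, a j x := by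
        rw [← Finset.mul_sum, Finset.sum_comm]
        congr 1
        rw [Finset.sum_comm, Finset.sum_congr rfl fun x _ => habel n x, Finset.sum_comm]
    _ ≤ r * ∑ k ∈ Finset.range n, ∑ x, (B (k + 1) x - B k x) * Y x := by
        refine mul_le_mul_of_nonneg_left (Finset.sum_le_sum fun k hk => ?_) (by linarith)
        refine h k (Finset.mem_range.1 hk) _ (fun x => sub_nonneg.2 (hBmono k x)) ?_
        intro x y hxy
        simp only [hBmeas k hxy, hBmeas' k hxy]
    _ = r * ∑ x, Y x * A n x ^ (r - 1) := by
        rw [Finset.sum_comm]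
        congr 1
        refine Finset.sum_congr rfl fun x _ => ?_
        rw [← Finset.sum_mul, Finset.sum_range_sub (fun k => B k x)]
        simp [hB, hn.ne']
        ring

/-- Doob's maximal inequality before Hölder's inequality is applied; the pathwise inequality
behind it is an Abel summation. -/
lemma doob_aux (h𝓕 : Antitone 𝓕) {q : ℝ} (hq : 1 < q) (n : ℕ) (s : ℕ → Ω → ℝ)
    (hs0 : ∀ k x, 0 ≤ s k x) (hs : ∀ k, ConstOn (𝓕 k) (s k))
    (h : ∀ k < n, ∀ φ : Ω → ℝ, (∀ x, 0 ≤ φ x) → ConstOn (𝓕 k) φ →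
      ∑ x, φ x * s k x ≤ ∑ x, φ x * s (k + 1) x) :
    (q - 1) * ∑ x, partialSups s n x ^ q ≤
      q * ∑ x, partialSups s n x ^ (q - 1) * s n x := by
  set S : ℕ → Ω → ℝ := fun k => partialSups s k with hS
  have hS0 : ∀ x, S 0 x = s 0 x := fun x => by simp [hS]
  have hSsucc : ∀ k x, S (k + 1) x = max (S k x) (s (k + 1) x) := by
    intro k x
    have := partialSups_succ s k
    simp only [Order.succ_eq_add_one] at this
    simp [hS, this]
  have hSs : ∀ k x, s k x ≤ S k x := fun k x => le_partialSups s k x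
  have hSnn : ∀ k x, 0 ≤ S k x := fun k x => (hs0 k x).trans (hSs k x)
  have hSmeas : ∀ k, ConstOn (𝓕 k) (S k) := by
    intro k
    induction k with
    | zero => intro x y hxy; rw [hS0, hS0, hs 0 hxy]
    | succ k ih =>
      intro x y hxy
      rw [hSsucc, hSsucc, hs (k + 1) hxy, ih (h𝓕 (Nat.le_succ k) hxy)]
  have hpath : ∀ m x, (q - 1) * S m x ^ q ≤ q * (S m x ^ (q - 1) * s m x -
      ∑ k ∈ Finset.range m, S k x ^ (q - 1) * (s (k + 1) x - s k x)) := by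
    intro m x
    have hmul : ∀ t : ℝ, 0 ≤ t → t ^ (q - 1) * t = t ^ q := by
      intro t ht
      rcases ht.eq_or_lt with rfl | ht
      · simp [Real.zero_rpow (by linarith : q ≠ 0)]
      · rw [← Real.rpow_add_one ht.ne']; congr 1; ring
    induction m with
    | zero =>
      simp only [Finset.range_zero, Finset.sum_empty, sub_zero, hS0, hmul _ (hs0 0 x)]
      have := Real.rpow_nonneg (hs0 0 x) q
      linarith
    | succ m ih =>
      rw [Finset.sum_range_succ, hSsucc]
      rcases le_total (s (m + 1) x) (S m x) with hle | hle
      · rw [max_eq_left hle]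
        linarith
      · rw [max_eq_right hle]
        have h1 := rpow_tangent_le hq.le (hs0 (m + 1) x) (hSnn m x)
        have h2 := hmul _ (hSnn m x)
        have h3 := hmul _ (hs0 (m + 1) x)
        rw [← h3] at h1 ⊢
        rw [← h2] at ih h1
        linarith
  have hsub : 0 ≤ ∑ x, ∑ k ∈ Finset.range n, S k x ^ (q - 1) * (s (k + 1) x - s k x) := by
    rw [Finset.sum_comm]
    refine Finset.sum_nonneg fun k hk => ?_
    have := h k (Finset.mem_range.1 hk) (fun x => S k x ^ (q - 1))
      (fun x => Real.rpow_nonneg (hSnn k x) _) (fun x y hxy => by simp only [hSmeas k hxy])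
    simp only [mul_sub, Finset.sum_sub_distrib]
    linarith
  calc (q - 1) * ∑ x, S n x ^ q = ∑ x, (q - 1) * S n x ^ q := Finset.mul_sum _ _ _
    _ ≤ ∑ x, q * (S n x ^ (q - 1) * s n x -
        ∑ k ∈ Finset.range n, S k x ^ (q - 1) * (s (k + 1) x - s k x)) :=
        Finset.sum_le_sum fun x _ => hpath n x
    _ = q * (∑ x, S n x ^ (q - 1) * s n x -
        ∑ x, ∑ k ∈ Finset.range n, S k x ^ (q - 1) * (s (k + 1) x - s k x)) := by
        rw [← Finset.mul_sum, Finset.sum_sub_distrib]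
    _ ≤ q * ∑ x, S n x ^ (q - 1) * s n x := by
        gcongr; linarith

end Martingale

lemma rpow_rpow_div {t r s : ℝ} (ht : 0 ≤ t) (hr : r ≠ 0) : (t ^ r) ^ (s / r) = t ^ s := by
  rw [← Real.rpow_mul ht, mul_div_cancel₀ _ hr]

/-- The Garsia–Neveu inequality in `L ^ r`. -/
lemma exists_garsia {r : ℝ} (hr : 1 ≤ r) :
    ∃ C : ℝ, 0 ≤ C ∧ ∀ {Ω : Type} [Fintype Ω] {𝓕 : ℕ → Setoid Ω} (_ : Antitone 𝓕) (n : ℕ)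
      (a : ℕ → Ω → ℝ) (Y : Ω → ℝ), (∀ k x, 0 ≤ a k x) → (∀ k, ConstOn (𝓕 k) (a k)) →
      (∀ x, 0 ≤ Y x) →
      (∀ k < n, ∀ φ : Ω → ℝ, (∀ x, 0 ≤ φ x) → ConstOn (𝓕 k) φ →
        ∑ x, φ x * ∑ j ∈ Finset.Ico k n, a j x ≤ ∑ x, φ x * Y x) →
      ∑ x, (∑ k ∈ Finset.range n, a k x) ^ r ≤ C * ∑ x, Y x ^ r := by
  have hr0 : r ≠ 0 := by linarith
  obtain ⟨C, hC0, hC⟩ := exists_le_of_holder (α := (r - 1) / r) (K := 1) (C := r)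
    (div_nonneg (by linarith) (by linarith)) (by rw [div_lt_one (by linarith)]; linarith)
    zero_le_one (by linarith)
  refine ⟨C, hC0, ?_⟩
  intro Ω _ 𝓕 h𝓕 n a Y ha0 ha hY h
  have hA0 : ∀ x, 0 ≤ ∑ k ∈ Finset.range n, a k x := fun x => Finset.sum_nonneg fun k _ => ha0 k x
  refine hC (fun x => (∑ k ∈ Finset.range n, a k x) ^ r) (fun x => Y x ^ r) _
    (fun x => Real.rpow_nonneg (hA0 x) _) (fun x => Real.rpow_nonneg (hY x) _) (by simp) ?_
  refine (garsia_aux h𝓕 hr n a Y ha0 ha hY h).trans_eq ?_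
  congr 1
  refine Finset.sum_congr rfl fun x _ => ?_
  rw [rpow_rpow_div (hA0 x) hr0, show 1 - (r - 1) / r = 1 / r by field_simp; ring,
    rpow_rpow_div (hY x) hr0, Real.rpow_one, mul_comm]

/-- Doob's maximal inequality in `L ^ q`. -/
lemma exists_doob {q : ℝ} (hq : 1 < q) :
    ∃ C : ℝ, 0 ≤ C ∧ ∀ {Ω : Type} [Fintype Ω] {𝓕 : ℕ → Setoid Ω} (_ : Antitone 𝓕) (n : ℕ)
      (s : ℕ → Ω → ℝ), (∀ k x, 0 ≤ s k x) → (∀ k, ConstOn (𝓕 k) (s k)) →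
      (∀ k < n, ∀ φ : Ω → ℝ, (∀ x, 0 ≤ φ x) → ConstOn (𝓕 k) φ →
        ∑ x, φ x * s k x ≤ ∑ x, φ x * s (k + 1) x) →
      ∑ x, partialSups s n x ^ q ≤ C * ∑ x, s n x ^ q := by
  have hq0 : q ≠ 0 := by linarith
  have hq1 : 0 < q - 1 := by linarith
  obtain ⟨C, hC0, hC⟩ := exists_le_of_holder (α := (q - 1) / q) (K := 1) (C := q / (q - 1))
    (div_nonneg (by linarith) (by linarith)) (by rw [div_lt_one (by linarith)]; linarith)
    zero_le_one (by positivity)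
  refine ⟨C, hC0, ?_⟩
  intro Ω _ 𝓕 h𝓕 n s hs0 hs h
  have hS0 : ∀ x, 0 ≤ partialSups s n x := fun x => (hs0 n x).trans (le_partialSups s n x)
  refine hC (fun x => partialSups s n x ^ q) (fun x => s n x ^ q) _
    (fun x => Real.rpow_nonneg (hS0 x) _) (fun x => Real.rpow_nonneg (hs0 n x) _) (by simp) ?_
  have h1 := doob_aux h𝓕 hq n s hs0 hs h
  rw [div_mul_eq_mul_div, le_div_iff₀ hq1, mul_comm]
  refine h1.trans_eq ?_
  congr 1
  refine Finset.sum_congr rfl fun x _ => ?_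
  rw [rpow_rpow_div (hS0 x) hq0, show 1 - (q - 1) / q = 1 / q by field_simp; ring,
    rpow_rpow_div (hs0 n x) hq0, Real.rpow_one]

section Hilbert

variable {H : Type*} [NormedAddCommGroup H] [InnerProductSpace ℝ H]

open scoped RealInnerProductSpace

/-- Convexity of `x ↦ ‖x‖ ^ q` on a Hilbert space, whose gradient is `q ‖x‖ ^ (q - 2) x`. -/
lemma norm_rpow_tangent_le {q : ℝ} (hq : 2 ≤ q) (x z : H) :
    ‖z‖ ^ q - ‖x‖ ^ q ≤ q * ⟪‖z‖ ^ (q - 2) • z, z - x⟫ := by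
  have h := rpow_tangent_le (by linarith : 1 ≤ q) (norm_nonneg x) (norm_nonneg z)
  have h1 : ‖z‖ ^ (q - 1) = ‖z‖ ^ (q - 2) * ‖z‖ := by
    rcases (norm_nonneg z).eq_or_lt with h0 | h0
    · rw [← h0, Real.zero_rpow (by linarith), mul_zero]
    · rw [← Real.rpow_add_one h0.ne']; congr 1; ring
  have h2 : ‖z‖ * ‖z‖ - ‖z‖ * ‖x‖ ≤ ⟪z, z - x⟫ := by
    rw [inner_sub_right, real_inner_self_eq_norm_mul_norm]
    linarith [real_inner_le_norm z x]
  have h3 : 0 ≤ ‖z‖ ^ (q - 2) := Real.rpow_nonneg (norm_nonneg z) _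
  rw [inner_smul_left]
  simp only [conj_trivial]
  have h4 := mul_le_mul_of_nonneg_left h2 (mul_nonneg (by linarith : 0 ≤ q) h3)
  rw [h1] at h
  linarith

/-- The map `x ↦ ‖x‖ ^ s x` is Lipschitz on balls. -/
lemma norm_rpow_smul_sub_le {s : ℝ} (hs : 0 ≤ s) (x y : H) {R : ℝ} (hx : ‖x‖ ≤ R) (hy : ‖y‖ ≤ R) :
    ‖‖x‖ ^ s • x - ‖y‖ ^ s • y‖ ≤ (s + 1) * R ^ s * ‖x - y‖ := by
  wlog hxy : ‖x‖ ≤ ‖y‖ generalizing x y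
  · rw [norm_sub_rev, norm_sub_rev x]
    exact this y x hy hx (le_of_not_ge hxy)
  have hys : ‖y‖ ^ s ≤ R ^ s := Real.rpow_le_rpow (norm_nonneg y) hy hs
  have hy0 : 0 ≤ ‖y‖ ^ s := Real.rpow_nonneg (norm_nonneg y) s
  have hmono : ‖x‖ ^ s ≤ ‖y‖ ^ s := Real.rpow_le_rpow (norm_nonneg x) hxy hs
  have hmul : ∀ t : ℝ, 0 ≤ t → t ^ (s + 1) = t ^ s * t := fun t ht => by
    rw [Real.rpow_add_one' ht (by linarith)]
  have h1 : (‖y‖ ^ s - ‖x‖ ^ s) * ‖x‖ ≤ s * ‖y‖ ^ s * (‖y‖ - ‖x‖) := by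
    have h := rpow_tangent_le (by linarith : 1 ≤ s + 1) (norm_nonneg x) (norm_nonneg y)
    rw [add_sub_cancel_right, hmul _ (norm_nonneg x), hmul _ (norm_nonneg y)] at h
    linarith
  have h2 : ‖y‖ - ‖x‖ ≤ ‖x - y‖ := by rw [norm_sub_rev]; exact norm_sub_norm_le y x
  calc ‖‖x‖ ^ s • x - ‖y‖ ^ s • y‖
      = ‖‖y‖ ^ s • (x - y) - (‖y‖ ^ s - ‖x‖ ^ s) • x‖ := by
        congr 1; rw [smul_sub, sub_smul]; abel
    _ ≤ ‖y‖ ^ s * ‖x - y‖ + (‖y‖ ^ s - ‖x‖ ^ s) * ‖x‖ := by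
        refine (norm_sub_le _ _).trans_eq ?_
        rw [norm_smul, norm_smul, Real.norm_of_nonneg hy0, Real.norm_of_nonneg (sub_nonneg.2 hmono)]
    _ ≤ ‖y‖ ^ s * ‖x - y‖ + s * ‖y‖ ^ s * ‖x - y‖ := by
        have h3 : s * ‖y‖ ^ s * (‖y‖ - ‖x‖) ≤ s * ‖y‖ ^ s * ‖x - y‖ := by gcongr
        linarith
    _ = (s + 1) * ‖y‖ ^ s * ‖x - y‖ := by ring
    _ ≤ (s + 1) * R ^ s * ‖x - y‖ := by gcongr

end Hilbert

open scoped RealInnerProductSpace in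
/-- The Burkholder inequality for martingales with values in a Hilbert space and exponents
`q ≥ 2`: the norm of the martingale is controlled by its square function. -/
lemma exists_burkholder {q : ℝ} (hq : 2 ≤ q) :
    ∃ C : ℝ, 0 ≤ C ∧ ∀ {Ω : Type} [Fintype Ω] {𝓕 : ℕ → Setoid Ω} (_ : Antitone 𝓕)
      {H : Type*} [NormedAddCommGroup H] [InnerProductSpace ℝ H] (n : ℕ) (d : ℕ → Ω → H),
      (∀ k, ConstOn (𝓕 (k + 1)) (d k)) →
      (∀ k < n, ∀ v : Ω → H, ConstOn (𝓕 k) v → ∑ x, ⟪v x, d k x⟫ = 0) →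
      ∑ x, ‖∑ k ∈ Finset.range n, d k x‖ ^ q ≤
        C * ∑ x, (∑ k ∈ Finset.range n, ‖d k x‖ ^ 2) ^ (q / 2) := by
  have hq0 : 0 < q := by linarith
  obtain ⟨K, hK0, hK⟩ := exists_doob (by linarith : 1 < q)
  obtain ⟨C, hC0, hC⟩ := exists_le_of_holder (α := (q - 2) / q) (K := K) (C := q * (q - 1))
    (div_nonneg (by linarith) hq0.le) (by rw [div_lt_one hq0]; linarith)
    hK0 (mul_nonneg hq0.le (by linarith))
  refine ⟨C, hC0, ?_⟩
  intro Ω _ 𝓕 h𝓕 H _ _ n d hd horth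
  set F : ℕ → Ω → H := fun m x => ∑ k ∈ Finset.range m, d k x with hF
  have hFsucc : ∀ m x, F (m + 1) x = F m x + d m x := fun m x => Finset.sum_range_succ _ _
  have hFmeas : ∀ m, ConstOn (𝓕 m) (F m) := fun m => ConstOn.sum fun j hj =>
    (hd j).mono (h𝓕 (Finset.mem_range.1 hj))
  set s : ℕ → Ω → ℝ := fun m x => ‖F m x‖ with hs
  have hs0 : ∀ m x, 0 ≤ s m x := fun m x => norm_nonneg _
  set S : Ω → ℝ := fun x => partialSups s n x with hS
  have hsS : ∀ m ≤ n, ∀ x, s m x ≤ S x := fun m hm x => le_partialSups_of_le s hm x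
  have hS0 : ∀ x, 0 ≤ S x := fun x => (hs0 n x).trans (hsS n le_rfl x)
  have hdoob : ∑ x, S x ^ q ≤ K * ∑ x, s n x ^ q := by
    refine hK h𝓕 n s hs0 (fun k x y hxy => by simp only [hs, hFmeas k hxy]) ?_
    intro k hk φ hφ0 hφ
    -- The norm of a martingale is a submartingale: test against `φ F_k / ‖F_k‖`.
    have h0 := horth k hk (fun x => (φ x * ‖F k x‖⁻¹) • F k x)
      (fun x y hxy => by simp only [hφ hxy, hFmeas k hxy])
    rw [← sub_nonneg, ← Finset.sum_sub_distrib, ← h0]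
    refine Finset.sum_le_sum fun x _ => ?_
    simp only [hs]
    rw [← mul_sub, inner_smul_left, conj_trivial, mul_assoc]
    refine mul_le_mul_of_nonneg_left ?_ (hφ0 x)
    rcases eq_or_ne (F k x) 0 with h | h
    · simp [h]
    · rw [inv_mul_le_iff₀ (norm_pos_iff.2 h), mul_sub, ← real_inner_self_eq_norm_mul_norm,
        show d k x = F (k + 1) x - F k x by rw [hFsucc]; abel, inner_sub_right]
      linarith [real_inner_le_norm (F k x) (F (k + 1) x)]
  have hstep : ∀ k < n, ∑ x, s (k + 1) x ^ q - ∑ x, s k x ^ q ≤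
      q * (q - 1) * ∑ x, S x ^ (q - 2) * ‖d k x‖ ^ 2 := by
    intro k hk
    have h0 := horth k hk (fun x => ‖F k x‖ ^ (q - 2) • F k x)
      (fun x y hxy => by simp only [hFmeas k hxy])
    rw [← Finset.sum_sub_distrib]
    calc ∑ x, (s (k + 1) x ^ q - s k x ^ q)
        ≤ ∑ x, q * ⟪‖F (k + 1) x‖ ^ (q - 2) • F (k + 1) x, d k x⟫ := by
          refine Finset.sum_le_sum fun x _ => ?_
          have := norm_rpow_tangent_le hq (F k x) (F (k + 1) x)
          rwa [show F (k + 1) x - F k x = d k x by rw [hFsucc]; abel] at this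
      _ = q * ∑ x, ⟪‖F (k + 1) x‖ ^ (q - 2) • F (k + 1) x - ‖F k x‖ ^ (q - 2) • F k x, d k x⟫ := by
          simp only [inner_sub_left, Finset.sum_sub_distrib]
          rw [h0, sub_zero, Finset.mul_sum]
      _ ≤ q * ∑ x, (q - 1) * (S x ^ (q - 2) * ‖d k x‖ ^ 2) := by
          gcongr with x
          refine (real_inner_le_norm _ _).trans ?_
          have := norm_rpow_smul_sub_le (by linarith : 0 ≤ q - 2) (F (k + 1) x) (F k x)
            (hsS (k + 1) hk x) (hsS k hk.le x)
          rw [show F (k + 1) x - F k x = d k x by rw [hFsucc]; abel] at this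
          calc _ ≤ (q - 2 + 1) * S x ^ (q - 2) * ‖d k x‖ * ‖d k x‖ := by gcongr
            _ = _ := by ring
      _ = _ := by rw [← Finset.mul_sum, mul_assoc]
  have htotal : ∑ x, s n x ^ q ≤
      q * (q - 1) * ∑ x, S x ^ (q - 2) * ∑ k ∈ Finset.range n, ‖d k x‖ ^ 2 := by
    have h1 := Finset.sum_le_sum fun k hk => hstep k (Finset.mem_range.1 hk)
    rw [Finset.sum_range_sub (fun k => ∑ x, s k x ^ q)] at h1
    have h2 : ∑ x, s 0 x ^ q = 0 := by
      simp [hs, hF, Real.zero_rpow hq0.ne']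
    rw [h2, sub_zero, ← Finset.mul_sum, Finset.sum_comm] at h1
    simpa only [← Finset.mul_sum] using h1
  have hQ0 : ∀ x, 0 ≤ ∑ k ∈ Finset.range n, ‖d k x‖ ^ 2 := fun x =>
    Finset.sum_nonneg fun k _ => by positivity
  refine hC (fun x => S x ^ q) (fun x => (∑ k ∈ Finset.range n, ‖d k x‖ ^ 2) ^ (q / 2)) _
    (fun x => Real.rpow_nonneg (hS0 x) _) (fun x => Real.rpow_nonneg (hQ0 x) _) hdoob ?_
  refine htotal.trans_eq ?_
  congr 1
  refine Finset.sum_congr rfl fun x _ => ?_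
  rw [rpow_rpow_div (hS0 x) hq0.ne', ← Real.rpow_mul (hQ0 x),
    show q / 2 * (1 - (q - 2) / q) = 1 by field_simp; ring, Real.rpow_one]

/-! ### Characters of a finite product of cyclic groups -/

lemma radix_succ (q : ℕ → ℕ) (k : ℕ) : radix q (k + 1) = radix q k * q k :=
  Finset.prod_range_succ _ _

lemma div_radix_succ (q : ℕ → ℕ) (n k : ℕ) : n / radix q (k + 1) = n / radix q k / q k := by
  rw [radix_succ, Nat.div_div_eq_div_mul]

lemma div_radix_congr {q : ℕ → ℕ} {n n' k l : ℕ} (hkl : k ≤ l)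
    (h : n / radix q k = n' / radix q k) : n / radix q l = n' / radix q l := by
  induction l, hkl using Nat.le_induction with
  | base => exact h
  | succ l _ ih => rw [div_radix_succ, div_radix_succ, ih]

lemma radix_pos (q : ℕ → ℕ) [∀ i, NeZero (q i)] (k : ℕ) : 0 < radix q k :=
  Finset.prod_pos fun i _ => Nat.pos_of_ne_zero (NeZero.ne (q i))

/-- The first `N` digits of a point of the unit interval, as an element of a finite group. -/
abbrev Digits (q : ℕ → ℕ) (N : ℕ) : Type := (i : Fin N) → ZMod (q i)

section Group

variable {q : ℕ → ℕ} {N : ℕ}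

/-- Two points are equivalent at level `k` if their first `k` digits agree: the atoms are the
cells of length `1 / m_k`. -/
def level (q : ℕ → ℕ) (N k : ℕ) : Setoid (Digits q N) where
  r x y := ∀ i : Fin N, (i : ℕ) < k → x i = y i
  iseqv := ⟨fun _ _ _ => rfl, fun h i hi => (h i hi).symm,
    fun h h' i hi => (h i hi).trans (h' i hi)⟩

lemma level_antitone : Antitone (level q N) := fun _ _ hkl _ _ h i hi => h i (hi.trans_le hkl)

/-- Frequencies that lie in different blocks of length `m_k` have different digits beyond `k`. -/
lemma exists_digit_ne {k n n' : ℕ} (hn : n < radix q N) (hn' : n' < radix q N)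
    (h : n / radix q k ≠ n' / radix q k) :
    ∃ i : Fin N, k ≤ i ∧ ((n / radix q i : ℕ) : ZMod (q i)) ≠
      ((n' / radix q i : ℕ) : ZMod (q i)) := by
  by_contra! hcon
  rcases le_total N k with hNk | hkN
  · exact h (div_radix_congr hNk (by rw [Nat.div_eq_of_lt hn, Nat.div_eq_of_lt hn']))
  · refine h (Nat.decreasingInduction' (P := fun l => n / radix q l = n' / radix q l)
      ?_ hkN (by rw [Nat.div_eq_of_lt hn, Nat.div_eq_of_lt hn']))
    intro i hiN hki ih
    have h1 := hcon ⟨i, hiN⟩ hki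
    rw [ZMod.natCast_eq_natCast_iff'] at h1
    simp only at h1
    rw [div_radix_succ, div_radix_succ] at ih
    rw [← Nat.div_add_mod (n / radix q i) (q i), h1, ih, Nat.div_add_mod]

variable [∀ i, NeZero (q i)]

/-- The Vilenkin function `w_n` as a character of the group of the first `N` digits. Reducing
`n / m_i` modulo `q i` gives the digit of `n` with index `i`. -/
noncomputable def char (q : ℕ → ℕ) [∀ i, NeZero (q i)] (N n : ℕ) : AddChar (Digits q N) ℂ where
  toFun x := ∏ i : Fin N, ZMod.stdAddChar (x i * ((n / radix q i : ℕ) : ZMod (q i)))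
  map_zero_eq_one' := by simp
  map_add_eq_mul' x y := by
    simp only [Pi.add_apply, add_mul, AddChar.map_add_eq_mul, Finset.prod_mul_distrib]

lemma char_apply (n : ℕ) (x : Digits q N) :
    char q N n x = ∏ i : Fin N, ZMod.stdAddChar (x i * ((n / radix q i : ℕ) : ZMod (q i))) := rfl

lemma char_mul_conj_self (n : ℕ) (x : Digits q N) :
    char q N n x * (starRingEnd ℂ) (char q N n x) = 1 := by
  rw [Complex.mul_conj, Complex.normSq_eq_norm_sq, AddChar.norm_apply]; simp

lemma stdAddChar_mul_conj_self {m : ℕ} [NeZero m] (u : ZMod m) :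
    (ZMod.stdAddChar u : ℂ) * (starRingEnd ℂ) (ZMod.stdAddChar u) = 1 := by
  rw [Complex.mul_conj, Complex.normSq_eq_norm_sq, AddChar.norm_apply]; simp

/-- Frequencies with the same digits from `k` on give the same character up to a factor that
depends only on the first `k` digits of the point. -/
lemma constOn_char_mul_conj {k n e : ℕ} (h : n / radix q k = e / radix q k) :
    ConstOn (level q N k) fun x => char q N n x * (starRingEnd ℂ) (char q N e x) := by
  intro x y hxy
  simp only [char_apply, map_prod, ← Finset.prod_mul_distrib]
  refine Finset.prod_congr rfl fun i _ => ?_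
  by_cases hi : (i : ℕ) < k
  · rw [hxy i hi]
  · rw [div_radix_congr (not_lt.1 hi) h, stdAddChar_mul_conj_self, stdAddChar_mul_conj_self]

/-- The translation by one in a digit beyond `k` preserves `φ` and multiplies the product of
characters by a nontrivial root of unity. -/
lemma sum_mul_char_eq_zero {k n n' : ℕ} (hn : n < radix q N) (hn' : n' < radix q N)
    (h : n / radix q k ≠ n' / radix q k) {φ : Digits q N → ℂ} (hφ : ConstOn (level q N k) φ) :
    ∑ x, φ x * (char q N n x * (starRingEnd ℂ) (char q N n' x)) = 0 := by
  obtain ⟨i, hki, hi⟩ := exists_digit_ne hn hn' h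
  set e : Digits q N := Pi.single i 1 with he
  have hchar : ∀ n, char q N n e = ZMod.stdAddChar ((n / radix q i : ℕ) : ZMod (q i)) := by
    intro n
    rw [char_apply, Finset.prod_eq_single i]
    · simp [he]
    · intro j _ hj; simp [he, hj]
    · simp
  set ζ := char q N n e * (starRingEnd ℂ) (char q N n' e) with hζ
  have hζ1 : ζ ≠ 1 := by
    intro h1
    apply hi
    apply ZMod.injective_stdAddChar
    have h2 := char_mul_conj_self n' e
    have h3 : (starRingEnd ℂ) (char q N n' e) ≠ 0 := right_ne_zero_of_mul_eq_one h2
    rw [← hchar, ← hchar]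
    exact mul_right_cancel₀ h3 (h1.trans h2.symm)
  have hφe : ∀ x, φ (x + e) = φ x := by
    intro x
    refine hφ fun j hj => ?_
    have : j ≠ i := fun hji => by subst hji; omega
    simp [he, this]
  have hsum : ∑ x, φ x * (char q N n x * (starRingEnd ℂ) (char q N n' x)) =
      ζ * ∑ x, φ x * (char q N n x * (starRingEnd ℂ) (char q N n' x)) := by
    conv_lhs => rw [← Equiv.sum_comp (Equiv.addRight e)]
    rw [Finset.mul_sum]
    refine Finset.sum_congr rfl fun x _ => ?_
    simp only [Equiv.coe_addRight, hφe, AddChar.map_add_eq_mul, map_mul, hζ]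
    ring
  have : (1 - ζ) * ∑ x, φ x * (char q N n x * (starRingEnd ℂ) (char q N n' x)) = 0 := by
    rw [sub_mul, one_mul, ← hsum, sub_self]
  exact (mul_eq_zero.1 this).resolve_left (sub_ne_zero.2 hζ1.symm)

/-- The Vilenkin polynomial with coefficients `c` and spectrum in `D`. -/
noncomputable def poly (c : ℕ → ℂ) (D : Finset ℕ) (x : Digits q N) : ℂ :=
  ∑ n ∈ D, c n * char q N n x

lemma sum_mul_poly_eq_zero {k : ℕ} {c c' : ℕ → ℂ} {D D' : Finset ℕ}
    (hD : D ⊆ Finset.range (radix q N)) (hD' : D' ⊆ Finset.range (radix q N))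
    (h : ∀ n ∈ D, ∀ n' ∈ D', n / radix q k ≠ n' / radix q k) {φ : Digits q N → ℂ}
    (hφ : ConstOn (level q N k) φ) :
    ∑ x, φ x * (poly c D x * (starRingEnd ℂ) (poly c' D' x)) = 0 := by
  have : ∀ x : Digits q N, φ x * (poly c D x * (starRingEnd ℂ) (poly c' D' x)) =
      ∑ n ∈ D, ∑ n' ∈ D', c n * (starRingEnd ℂ) (c' n') *
        (φ x * (char q N n x * (starRingEnd ℂ) (char q N n' x))) := by
    intro x
    simp only [poly, map_sum, map_mul]
    rw [Finset.sum_mul_sum]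
    simp only [Finset.mul_sum]
    refine Finset.sum_congr rfl fun n _ => Finset.sum_congr rfl fun n' _ => ?_
    ring
  simp only [this]
  rw [Finset.sum_comm]
  refine Finset.sum_eq_zero fun n hn => ?_
  rw [Finset.sum_comm]
  refine Finset.sum_eq_zero fun n' hn' => ?_
  rw [← Finset.mul_sum, sum_mul_char_eq_zero (Finset.mem_range.1 (hD hn))
    (Finset.mem_range.1 (hD' hn')) (h n hn n' hn') hφ, mul_zero]

lemma poly_union {c : ℕ → ℂ} {D D' : Finset ℕ} (h : Disjoint D D') (x : Digits q N) :
    poly c (D ∪ D') x = poly c D x + poly c D' x := Finset.sum_union h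

lemma constOn_poly_mul_conj {k e : ℕ} {c : ℕ → ℂ} {D : Finset ℕ}
    (h : ∀ n ∈ D, n / radix q k = e / radix q k) :
    ConstOn (level q N k) fun x => poly c D x * (starRingEnd ℂ) (char q N e x) := by
  simp only [poly, Finset.sum_mul, mul_assoc]
  refine ConstOn.sum fun n hn x y hxy => ?_
  have := constOn_char_mul_conj (h n hn) hxy
  simp only at this
  rw [this]

lemma norm_mul_conj_char (z : ℂ) (e : ℕ) (x : Digits q N) :
    ‖z * (starRingEnd ℂ) (char q N e x)‖ = ‖z‖ := by
  rw [norm_mul, RCLike.norm_conj, AddChar.norm_apply, mul_one]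

/-- Pythagoras for spectra that are separated at scale `m_k`, localized to the cells of level
`k`. -/
lemma sum_mul_norm_sq_add {k : ℕ} {c : ℕ → ℂ} {D D' : Finset ℕ}
    (hD : D ⊆ Finset.range (radix q N)) (hD' : D' ⊆ Finset.range (radix q N))
    (h : ∀ n ∈ D, ∀ n' ∈ D', n / radix q k ≠ n' / radix q k) {φ : Digits q N → ℝ}
    (hφ : ConstOn (level q N k) φ) :
    ∑ x, φ x * ‖poly c D x + poly c D' x‖ ^ 2 =
      ∑ x, φ x * ‖poly c D x‖ ^ 2 + ∑ x, φ x * ‖poly c D' x‖ ^ 2 := by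
  have h0 := sum_mul_poly_eq_zero (c := c) (c' := c) hD hD' h (φ := fun x => (φ x : ℂ))
    (fun x y hxy => by simp only [hφ hxy])
  have h1 : ∑ x, φ x * (poly c D x * (starRingEnd ℂ) (poly c D' x)).re = 0 := by
    have := congrArg Complex.re h0
    rw [Complex.re_sum] at this
    simpa only [Complex.re_ofReal_mul, Complex.zero_re] using this
  have h2 : ∀ x : Digits q N, φ x * ‖poly c D x + poly c D' x‖ ^ 2 =
      φ x * ‖poly c D x‖ ^ 2 + φ x * ‖poly c D' x‖ ^ 2 +
        2 * (φ x * (poly c D x * (starRingEnd ℂ) (poly c D' x)).re) := by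
    intro x
    simp only [← Complex.normSq_eq_norm_sq, Complex.normSq_add]
    ring
  simp only [h2, Finset.sum_add_distrib, ← Finset.mul_sum, h1]
  ring

/-- Bessel's inequality, localized to the cells of level `k`, for disjoint unions of frequency
blocks of length `m_k`. -/
lemma sum_mul_norm_sq_poly_le {ι : Type*} {k : ℕ} {c : ℕ → ℂ} (I : Finset ι) (D : ι → Finset ℕ)
    (hD : ∀ i ∈ I, D i ⊆ Finset.range (radix q N))
    (hdisj : (I : Set ι).PairwiseDisjoint D)
    (hsat : ∀ i ∈ I, ∀ n ∈ D i, ∀ n' < radix q N, n' / radix q k = n / radix q k → n' ∈ D i)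
    {φ : Digits q N → ℝ} (hφ0 : ∀ x, 0 ≤ φ x) (hφ : ConstOn (level q N k) φ) :
    ∑ x, φ x * ∑ i ∈ I, ‖poly c (D i) x‖ ^ 2 ≤
      ∑ x, φ x * ‖poly c (Finset.range (radix q N)) x‖ ^ 2 := by
  classical
  have hbi : ∀ I' ⊆ I, I'.biUnion D ⊆ Finset.range (radix q N) := fun I' hI' =>
    Finset.biUnion_subset.2 fun i hi => hD i (hI' hi)
  have key : ∀ I' ⊆ I, ∑ x, φ x * ∑ i ∈ I', ‖poly c (D i) x‖ ^ 2 =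
      ∑ x, φ x * ‖poly c (I'.biUnion D) x‖ ^ 2 := by
    intro I'
    induction I' using Finset.induction_on with
    | empty => intro _; simp [poly]
    | insert i I' hi ih =>
      intro hsub
      have hsub' : I' ⊆ I := fun j hj => hsub (Finset.mem_insert_of_mem hj)
      have hiI : i ∈ I := hsub (Finset.mem_insert_self _ _)
      have hdis : Disjoint (D i) (I'.biUnion D) := by
        rw [Finset.disjoint_biUnion_right]
        intro j hj
        exact hdisj hiI (hsub' hj) fun hij => hi (hij ▸ hj)
      simp only [Finset.sum_insert hi, mul_add, Finset.sum_add_distrib, Finset.biUnion_insert,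
        poly_union hdis]
      rw [ih hsub', sum_mul_norm_sq_add (hD i hiI) (hbi I' hsub') ?_ hφ]
      intro n hn n' hn' hnn
      exact Finset.disjoint_left.1 hdis
        (hsat i hiI n hn n' (Finset.mem_range.1 (hbi I' hsub' hn')) hnn.symm) hn'
  rw [key I subset_rfl]
  have hsp := sum_mul_norm_sq_add (c := c) (hbi I subset_rfl)
    (Finset.sdiff_subset (s := Finset.range (radix q N)) (t := I.biUnion D)) (k := k) ?_ hφ
  · rw [show (∑ x, φ x * ‖poly c (Finset.range (radix q N)) x‖ ^ 2) =
      ∑ x, φ x * ‖poly c (I.biUnion D) x +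
        poly c (Finset.range (radix q N) \ I.biUnion D) x‖ ^ 2 by
          simp only [← poly_union Finset.disjoint_sdiff,
            Finset.union_sdiff_of_subset (hbi I subset_rfl)], hsp]
    have : 0 ≤ ∑ x, φ x * ‖poly c (Finset.range (radix q N) \ I.biUnion D) x‖ ^ 2 :=
      Finset.sum_nonneg fun x _ => mul_nonneg (hφ0 x) (by positivity)
    linarith
  · intro n hn n' hn' hnn
    obtain ⟨i, hi, hni⟩ := Finset.mem_biUnion.1 hn
    rw [Finset.mem_sdiff, Finset.mem_range] at hn'
    exact hn'.2 (Finset.mem_biUnion.2 ⟨i, hi, hsat i hi n hni n' hn'.1 hnn.symm⟩)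

lemma char_injOn : Set.InjOn (char q N) (Set.Iio (radix q N)) := by
  intro n hn n' hn' h
  by_contra hne
  have h0 := sum_mul_char_eq_zero (k := 0) hn hn' (by simpa [radix] using hne)
    (φ := fun _ => 1) (fun _ _ _ => rfl)
  rw [← h] at h0
  simp [char_mul_conj_self, Finset.prod_eq_zero_iff, NeZero.ne] at h0

/-- Completeness of the Vilenkin system, by counting dimensions. -/
lemma exists_poly_eq (g : Digits q N → ℂ) :
    ∃ c : ℕ → ℂ, ∀ x, poly c (Finset.range (radix q N)) x = g x := by
  set b : Fin (radix q N) → Digits q N → ℂ := fun n => char q N n with hb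
  have hli : LinearIndependent ℂ b :=
    (AddChar.linearIndependent (Digits q N) ℂ).comp (fun n : Fin (radix q N) => char q N n)
      fun n n' h => Fin.ext (char_injOn n.2 n'.2 h)
  have hcard : Fintype.card (Fin (radix q N)) = Module.finrank ℂ (Digits q N → ℂ) := by
    rw [Module.finrank_fintype_fun_eq_card, Fintype.card_fin, Fintype.card_pi, radix]
    simp only [ZMod.card]
    exact (Fin.prod_univ_eq_prod_range q N).symm
  have : Nonempty (Fin (radix q N)) := ⟨⟨0, radix_pos q N⟩⟩
  have hspan := hli.span_eq_top_of_card_eq_finrank hcard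
  have hg : g ∈ Submodule.span ℂ (Set.range b) := hspan ▸ Submodule.mem_top
  obtain ⟨c, hc⟩ := (Submodule.mem_span_range_iff_exists_fun ℂ).1 hg
  refine ⟨fun n => if h : n < radix q N then c ⟨n, h⟩ else 0, fun x => ?_⟩
  rw [← hc, poly, ← Fin.sum_univ_eq_sum_range
    (fun n => (if h : n < radix q N then c ⟨n, h⟩ else 0) * char q N n x)]
  simp [hb]

end Group

/-! ### The square function of disjoint intervals -/

/-- The spectrum up to `m_N` inside the union of the blocks `{n | n / m_k = j}`, `j ∈ J`. -/
def blocks (q : ℕ → ℕ) (N k : ℕ) (J : Finset ℕ) : Finset ℕ :=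
  (Finset.range (radix q N)).filter fun n => n / radix q k ∈ J

lemma mem_blocks {q : ℕ → ℕ} {N k n : ℕ} {J : Finset ℕ} :
    n ∈ blocks q N k J ↔ n < radix q N ∧ n / radix q k ∈ J := by
  simp [blocks]

lemma blocks_subset {q : ℕ → ℕ} {N k : ℕ} {J : Finset ℕ} :
    blocks q N k J ⊆ Finset.range (radix q N) := Finset.filter_subset _ _

/-- On a single block of length `m_k` the modulus of a polynomial depends on the first `k` digits
only. -/
lemma constOn_norm_poly_block {q : ℕ → ℕ} {N : ℕ} [∀ i, NeZero (q i)] (c : ℕ → ℂ) (k j : ℕ) :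
    ConstOn (level q N k) fun x => ‖poly c (blocks q N k {j}) x‖ := by
  intro x y hxy
  have h := constOn_poly_mul_conj (q := q) (N := N) (k := k) (e := j * radix q k) (c := c)
    (D := blocks q N k {j}) (fun n hn => by
      rw [Nat.mul_div_cancel _ (radix_pos q k)]
      simpa using (mem_blocks.1 hn).2) hxy
  have h' := congrArg norm h
  simpa only [norm_mul_conj_char] using h'

/-- The square function inequality for pairwise disjoint frequency blocks `{n | n / m_k = j}`,
`j ∈ J k`: the squared moduli of the blocks at scale `k` are adapted to level `k`, so that the
local Bessel inequality is exactly the hypothesis of the Garsia–Neveu inequality. -/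
lemma exists_block_square {r : ℝ} (hr : 1 ≤ r) :
    ∃ C : ℝ, 0 ≤ C ∧ ∀ (q : ℕ → ℕ) [∀ i, NeZero (q i)] (N : ℕ) (J : ℕ → Finset ℕ) (c : ℕ → ℂ),
      (∀ n k k', n / radix q k ∈ J k → n / radix q k' ∈ J k' → k = k') →
      ∑ x : Digits q N, (∑ k ∈ Finset.range N, ∑ j ∈ J k, ‖poly c (blocks q N k {j}) x‖ ^ 2) ^ r ≤
        C * ∑ x : Digits q N, (‖poly c (Finset.range (radix q N)) x‖ ^ 2) ^ r := by
  obtain ⟨C, hC0, hC⟩ := exists_garsia hr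
  refine ⟨C, hC0, ?_⟩
  intro q _ N J c hJ
  refine hC (level_antitone (q := q) (N := N)) N
    (fun k x => ∑ j ∈ J k, ‖poly c (blocks q N k {j}) x‖ ^ 2) _
    (fun k x => Finset.sum_nonneg fun j _ => by positivity)
    (fun k => ConstOn.sum fun j _ x y hxy => ?_) (fun x => by positivity) ?_
  · exact congrArg (· ^ 2) (constOn_norm_poly_block c k j hxy)
  intro k hk φ hφ0 hφ
  have h := sum_mul_norm_sq_poly_le (c := c) ((Finset.Ico k N).sigma fun l => J l)
    (fun p => blocks q N p.1 {p.2}) (fun _ _ => blocks_subset) ?_ ?_ hφ0 hφ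
  · simpa only [Finset.sum_sigma] using h
  · rintro ⟨l, j⟩ hl ⟨l', j'⟩ hl' hne
    rw [Function.onFun, Finset.disjoint_left]
    intro n hn hn'
    simp only [mem_blocks, Finset.mem_singleton] at hn hn'
    simp only [Finset.mem_coe, Finset.mem_sigma] at hl hl'
    obtain rfl : l = l' := hJ n l l' (hn.2 ▸ hl.2) (hn'.2 ▸ hl'.2)
    exact hne (by rw [← hn.2, ← hn'.2])
  · rintro ⟨l, j⟩ hl n hn n' hn' hnn'
    simp only [Finset.mem_sigma, Finset.mem_Ico] at hl
    simp only [mem_blocks, Finset.mem_singleton] at hn ⊢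
    exact ⟨hn', by rw [div_radix_congr hl.1.1 hnn', hn.2]⟩

lemma norm_sq_rpow_div_two {E : Type*} [SeminormedAddGroup E] (z : E) (Q : ℝ) :
    (‖z‖ ^ 2) ^ (Q / 2) = ‖z‖ ^ Q := by
  rw [← Real.rpow_natCast, ← Real.rpow_mul (norm_nonneg _)]
  congr 1; push_cast; ring

lemma poly_blocks {q : ℕ → ℕ} {N : ℕ} [∀ i, NeZero (q i)] (c : ℕ → ℂ) (k : ℕ) (J : Finset ℕ)
    (x : Digits q N) : poly c (blocks q N k J) x = ∑ j ∈ J, poly c (blocks q N k {j}) x := by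
  simp only [poly]
  rw [← Finset.sum_fiberwise_of_maps_to (t := J) (g := fun n => n / radix q k)
    fun n hn => (mem_blocks.1 hn).2]
  refine Finset.sum_congr rfl fun j hj => Finset.sum_congr ?_ fun _ _ => rfl
  ext n
  simp only [Finset.mem_filter, mem_blocks, Finset.mem_singleton]
  constructor
  · rintro ⟨⟨h1, _⟩, h2⟩; exact ⟨h1, h2⟩
  · rintro ⟨h1, h2⟩; exact ⟨⟨h1, h2 ▸ hj⟩, h2⟩

lemma norm_sq_poly_blocks_le {q : ℕ → ℕ} {N : ℕ} [∀ i, NeZero (q i)] (c : ℕ → ℂ) (k : ℕ)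
    {J : Finset ℕ} {M : ℕ} (hJ : J.card ≤ M) (x : Digits q N) :
    ‖poly c (blocks q N k J) x‖ ^ 2 ≤ M * ∑ j ∈ J, ‖poly c (blocks q N k {j}) x‖ ^ 2 := by
  rw [poly_blocks]
  calc ‖∑ j ∈ J, poly c (blocks q N k {j}) x‖ ^ 2
      ≤ (∑ j ∈ J, ‖poly c (blocks q N k {j}) x‖) ^ 2 := by gcongr; exact norm_sum_le _ _
    _ ≤ J.card * ∑ j ∈ J, ‖poly c (blocks q N k {j}) x‖ ^ 2 := sq_sum_le_card_mul_sum_sq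
    _ ≤ _ := by gcongr

/-- The square function inequality for sums of blocks which become martingales after a modulation:
the blocks `J t k` of length `m_k` lie in the same block of length `m_{k+1}` as `e t`, but not in
the same block of length `m_k`, so that their sum times the conjugate of `w_{e t}` is a martingale
difference. -/
lemma exists_modulated_square {Q : ℝ} (hQ : 2 ≤ Q) (M : ℕ) :
    ∃ C : ℝ, 0 ≤ C ∧ ∀ (q : ℕ → ℕ) [∀ i, NeZero (q i)] (_ : ∀ i, q i ≤ M) (N : ℕ)
      (T : Type*) [Fintype T] (e : T → ℕ) (J : T → ℕ → Finset ℕ) (c : ℕ → ℂ),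
      (∀ t, e t < radix q N) →
      (∀ t k, ∀ j ∈ J t k, j ≠ e t / radix q k ∧ j / q k = e t / radix q (k + 1)) →
      (∀ n t t' k k', n / radix q k ∈ J t k → n / radix q k' ∈ J t' k' → t = t' ∧ k = k') →
      ∑ x : Digits q N,
          (∑ t, ‖∑ k ∈ Finset.range N, poly c (blocks q N k (J t k)) x‖ ^ 2) ^ (Q / 2) ≤
        C * ∑ x : Digits q N, ‖poly c (Finset.range (radix q N)) x‖ ^ Q := by
  classical
  obtain ⟨C₁, hC₁0, hC₁⟩ := exists_burkholder hQ
  obtain ⟨C₂, hC₂0, hC₂⟩ := exists_block_square (r := Q / 2) (by linarith)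
  refine ⟨C₁ * ((M : ℝ) ^ (Q / 2) * C₂), by positivity, ?_⟩
  intro q _ hM N T _ e J c he hJ hdisj
  have hcard : ∀ t k, (J t k).card ≤ M := by
    intro t k
    have : J t k ⊆ Finset.Ico (e t / radix q (k + 1) * q k)
        (e t / radix q (k + 1) * q k + q k) := by
      intro j hj
      rw [Finset.mem_Ico, ← (hJ t k j hj).2]
      have h1 := Nat.div_add_mod' j (q k)
      have h2 := Nat.mod_lt j (Nat.pos_of_ne_zero (NeZero.ne (q k)))
      omega
    refine (Finset.card_le_card this).trans ?_
    rw [Nat.card_Ico, Nat.add_sub_cancel_left]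
    exact hM k
  set d : ℕ → Digits q N → EuclideanSpace ℂ T := fun k x => WithLp.toLp 2 fun t =>
    poly c (blocks q N k (J t k)) x * (starRingEnd ℂ) (char q N (e t) x) with hd
  have hdnorm : ∀ k x, ‖d k x‖ ^ 2 = ∑ t, ‖poly c (blocks q N k (J t k)) x‖ ^ 2 := by
    intro k x
    simp only [hd, EuclideanSpace.norm_sq_eq, norm_mul_conj_char]
  have hsumnorm : ∀ x, ‖∑ k ∈ Finset.range N, d k x‖ ^ 2 =
      ∑ t, ‖∑ k ∈ Finset.range N, poly c (blocks q N k (J t k)) x‖ ^ 2 := by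
    intro x
    rw [EuclideanSpace.norm_sq_eq]
    refine Finset.sum_congr rfl fun t _ => ?_
    simp only [hd, WithLp.ofLp_sum, Finset.sum_apply, ← Finset.sum_mul, norm_mul_conj_char]
  have hburk := hC₁ (level_antitone (q := q) (N := N)) N d ?_ ?_
  · have h1 : ∀ x : Digits q N, ‖∑ k ∈ Finset.range N, d k x‖ ^ Q =
        (∑ t, ‖∑ k ∈ Finset.range N, poly c (blocks q N k (J t k)) x‖ ^ 2) ^ (Q / 2) := by
      intro x
      rw [← hsumnorm, norm_sq_rpow_div_two]
    simp only [h1] at hburk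
    refine hburk.trans ?_
    rw [mul_assoc]
    refine mul_le_mul_of_nonneg_left ?_ hC₁0
    set J' : ℕ → Finset ℕ := fun k => Finset.univ.biUnion fun t => J t k with hJ'
    have hsq := hC₂ q N J' c (by
      intro n k k' hk hk'
      simp only [hJ', Finset.mem_biUnion, Finset.mem_univ, true_and] at hk hk'
      obtain ⟨t, ht⟩ := hk
      obtain ⟨t', ht'⟩ := hk'
      exact (hdisj n t t' k k' ht ht').2)
    simp only [norm_sq_rpow_div_two] at hsq
    rw [mul_assoc]
    refine le_trans ?_ (mul_le_mul_of_nonneg_left hsq (by positivity))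
    rw [Finset.mul_sum]
    refine Finset.sum_le_sum fun x _ => ?_
    rw [← Real.mul_rpow (by positivity) (by positivity)]
    refine Real.rpow_le_rpow (by positivity) ?_ (by linarith)
    rw [Finset.mul_sum]
    refine Finset.sum_le_sum fun k _ => ?_
    rw [hdnorm, hJ', Finset.sum_biUnion, Finset.mul_sum]
    · exact Finset.sum_le_sum fun t _ => norm_sq_poly_blocks_le c k (hcard t k) x
    · intro t _ t' _ htt'
      rw [Function.onFun, Finset.disjoint_left]
      intro j hj hj'
      have h3 : j * radix q k / radix q k = j := Nat.mul_div_cancel _ (radix_pos q k)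
      exact htt' (hdisj (j * radix q k) t t' k k (h3.symm ▸ hj) (h3.symm ▸ hj')).1
  · intro k x y hxy
    simp only [hd]
    congr 1
    funext t
    refine constOn_poly_mul_conj (fun n hn => ?_) hxy
    rw [div_radix_succ, (hJ t k _ (mem_blocks.1 hn).2).2]
  · intro k hk v hv
    have h0 : ∀ t, ∑ x, (starRingEnd ℂ) (v x t) * (poly c (blocks q N k (J t k)) x *
        (starRingEnd ℂ) (char q N (e t) x)) = 0 := by
      intro t
      have := sum_mul_poly_eq_zero (q := q) (N := N) (k := k) (c := c) (c' := fun _ => 1)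
        (D := blocks q N k (J t k)) (D' := {e t}) blocks_subset (by simpa using he t) ?_
        (φ := fun x => (starRingEnd ℂ) (v x t)) (fun x y hxy => by simp only [hv hxy])
      · simpa [poly] using this
      · intro n hn n' hn'
        rw [Finset.mem_singleton.1 hn']
        exact (hJ t k _ (mem_blocks.1 hn).2).1
    have h1 : ∀ x, inner ℝ (v x) (d k x) = ∑ t, ((starRingEnd ℂ) (v x t) *
        (poly c (blocks q N k (J t k)) x * (starRingEnd ℂ) (char q N (e t) x))).re := by
      intro x
      rw [PiLp.inner_apply]
      exact Finset.sum_congr rfl fun t _ => (Complex.inner _ _).trans (by rw [mul_comm])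
    simp only [h1]
    rw [Finset.sum_comm]
    refine Finset.sum_eq_zero fun t _ => ?_
    rw [← Complex.re_sum, h0, Complex.zero_re]

/-- The blocks of length `m_k` strictly between `a` and `b` which share their block of length
`m_{k+1}` with `a`. -/
def leftBlocks (q : ℕ → ℕ) (a b k : ℕ) : Finset ℕ :=
  (Finset.Ioo (a / radix q k) (b / radix q k)).filter fun j => j / q k = a / radix q (k + 1)

/-- The blocks of length `m_k` strictly between `a` and `b` which share their block of length
`m_{k+1}` with `b` but not with `a`. -/
def rightBlocks (q : ℕ → ℕ) (a b k : ℕ) : Finset ℕ :=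
  (Finset.Ioo (a / radix q k) (b / radix q k)).filter fun j =>
    j / q k = b / radix q (k + 1) ∧ a / radix q (k + 1) < j / q k

section Blocks

variable {q : ℕ → ℕ} {a b n k k' : ℕ}

lemma mem_leftBlocks : n / radix q k ∈ leftBlocks q a b k ↔
    (a / radix q k < n / radix q k ∧ n / radix q k < b / radix q k) ∧
      n / radix q (k + 1) = a / radix q (k + 1) := by
  simp [leftBlocks, div_radix_succ]

lemma mem_rightBlocks : n / radix q k ∈ rightBlocks q a b k ↔
    (a / radix q k < n / radix q k ∧ n / radix q k < b / radix q k) ∧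
      n / radix q (k + 1) = b / radix q (k + 1) ∧
        a / radix q (k + 1) < n / radix q (k + 1) := by
  simp [rightBlocks, div_radix_succ]

lemma lt_of_div_radix_lt {n n' k : ℕ} (h : n / radix q k < n' / radix q k) : n < n' :=
  lt_of_not_ge fun h' => absurd (Nat.div_le_div_right h') (not_le.2 h)

lemma leftBlocks_unique (h : n / radix q k ∈ leftBlocks q a b k)
    (h' : n / radix q k' ∈ leftBlocks q a b k') : k = k' := by
  wlog hlt : k < k' generalizing k k'
  · rcases (not_lt.1 hlt).eq_or_lt with h1 | h1
    · exact h1.symm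
    · exact (this h' h h1).symm
  exact absurd (div_radix_congr hlt (mem_leftBlocks.1 h).2) (mem_leftBlocks.1 h').1.1.ne'

lemma rightBlocks_unique (h : n / radix q k ∈ rightBlocks q a b k)
    (h' : n / radix q k' ∈ rightBlocks q a b k') : k = k' := by
  wlog hlt : k < k' generalizing k k'
  · rcases (not_lt.1 hlt).eq_or_lt with h1 | h1
    · exact h1.symm
    · exact (this h' h h1).symm
  exact absurd (div_radix_congr hlt (mem_rightBlocks.1 h).2.1) (mem_rightBlocks.1 h').1.2.ne

lemma leftBlocks_rightBlocks (h : n / radix q k ∈ leftBlocks q a b k)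
    (h' : n / radix q k' ∈ rightBlocks q a b k') : False := by
  rw [mem_leftBlocks] at h
  rw [mem_rightBlocks] at h'
  rcases le_or_gt k k' with hle | hlt
  · exact absurd (div_radix_congr (Nat.succ_le_succ hle) h.2) h'.2.2.ne'
  · exact absurd (div_radix_congr hlt h'.2.1) h.1.2.ne

/-- The largest block containing `n` strictly between `a` and `b` is a left block or a right
block. -/
lemma exists_mem_blocks {N : ℕ} (han : a < n) (hnb : n < b) (hbN : b < radix q N) :
    (∃ k < N, n / radix q k ∈ leftBlocks q a b k) ∨
      ∃ k < N, n / radix q k ∈ rightBlocks q a b k := by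
  classical
  have hN : ¬ (a / radix q N < n / radix q N ∧ n / radix q N < b / radix q N) := by
    rw [Nat.div_eq_of_lt hbN]; simp
  have hex : ∃ k, ¬ (a / radix q k < n / radix q k ∧ n / radix q k < b / radix q k) := ⟨N, hN⟩
  have hfind := Nat.find_spec hex
  have hfindN : Nat.find hex ≤ N := Nat.find_min' hex hN
  have hpos : Nat.find hex ≠ 0 := by
    intro h0
    rw [h0] at hfind
    exact hfind (by simpa [radix] using ⟨han, hnb⟩)
  obtain ⟨k, hk⟩ := Nat.exists_eq_succ_of_ne_zero hpos
  have hk1 := not_not.1 (Nat.find_min hex (m := k) (by omega))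
  rw [hk] at hfind
  have hmono1 : a / radix q (k + 1) ≤ n / radix q (k + 1) := Nat.div_le_div_right han.le
  have hmono2 : n / radix q (k + 1) ≤ b / radix q (k + 1) := Nat.div_le_div_right hnb.le
  rcases hmono1.eq_or_lt with h1 | h1
  · exact Or.inl ⟨k, by omega, mem_leftBlocks.2 ⟨hk1, h1.symm⟩⟩
  · refine Or.inr ⟨k, by omega, mem_rightBlocks.2 ⟨hk1, ?_, h1⟩⟩
    exact hmono2.antisymm (not_lt.1 fun h2 => hfind ⟨h1, h2⟩)

end Blocks

lemma poly_Ico {q : ℕ → ℕ} [∀ i, NeZero (q i)] {N a b : ℕ} (hb : b < radix q N) (c : ℕ → ℂ)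
    (x : Digits q N) :
    poly c (Finset.Ico a b) x = poly c ((Finset.Ico a b).filter (· = a)) x +
      ∑ k ∈ Finset.range N, poly c (blocks q N k (leftBlocks q a b k)) x +
      ∑ k ∈ Finset.range N, poly c (blocks q N k (rightBlocks q a b k)) x := by
  classical
  have hL : ∑ k ∈ Finset.range N, poly c (blocks q N k (leftBlocks q a b k)) x =
      poly c ((Finset.range N).biUnion fun k => blocks q N k (leftBlocks q a b k)) x := by
    simp only [poly]
    rw [Finset.sum_biUnion]
    intro k _ k' _ hkk'
    exact Finset.disjoint_left.2 fun n hn hn' =>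
      hkk' (leftBlocks_unique (mem_blocks.1 hn).2 (mem_blocks.1 hn').2)
  have hR : ∑ k ∈ Finset.range N, poly c (blocks q N k (rightBlocks q a b k)) x =
      poly c ((Finset.range N).biUnion fun k => blocks q N k (rightBlocks q a b k)) x := by
    simp only [poly]
    rw [Finset.sum_biUnion]
    intro k _ k' _ hkk'
    exact Finset.disjoint_left.2 fun n hn hn' =>
      hkk' (rightBlocks_unique (mem_blocks.1 hn).2 (mem_blocks.1 hn').2)
  rw [hL, hR, ← poly_union, ← poly_union]
  · congr 1
    ext n
    simp only [Finset.mem_union, Finset.mem_filter, Finset.mem_biUnion, mem_blocks,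
      Finset.mem_Ico, Finset.mem_range]
    constructor
    · rintro ⟨h1, h2⟩
      rcases h1.eq_or_lt with rfl | h1
      · exact Or.inl (Or.inl ⟨⟨le_rfl, h2⟩, rfl⟩)
      · rcases exists_mem_blocks h1 h2 hb with ⟨k, hk, h⟩ | ⟨k, hk, h⟩
        · exact Or.inl (Or.inr ⟨k, hk, h2.trans hb, h⟩)
        · exact Or.inr ⟨k, hk, h2.trans hb, h⟩
    · rintro ((⟨h, _⟩ | ⟨k, _, _, h⟩) | ⟨k, _, _, h⟩)
      · exact h
      · have := (mem_leftBlocks.1 h).1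
        exact ⟨(lt_of_div_radix_lt this.1).le, lt_of_div_radix_lt this.2⟩
      · have := (mem_rightBlocks.1 h).1
        exact ⟨(lt_of_div_radix_lt this.1).le, lt_of_div_radix_lt this.2⟩
  · rw [Finset.disjoint_left]
    intro n hn hn'
    simp only [Finset.mem_union, Finset.mem_filter, Finset.mem_biUnion, mem_blocks] at hn hn'
    obtain ⟨k', _, _, h'⟩ := hn'
    rcases hn with ⟨_, rfl⟩ | ⟨k, _, _, h⟩
    · exact absurd (mem_rightBlocks.1 h').1.1 (lt_irrefl _)
    · exact leftBlocks_rightBlocks h h'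
  · rw [Finset.disjoint_left]
    intro n hn hn'
    simp only [Finset.mem_filter, Finset.mem_biUnion, mem_blocks] at hn hn'
    obtain ⟨k', _, _, h'⟩ := hn'
    obtain ⟨_, rfl⟩ := hn
    exact absurd (mem_leftBlocks.1 h').1.1 (lt_irrefl _)

lemma three_mul_add_rpow_le {X Y Z r : ℝ} (hX : 0 ≤ X) (hY : 0 ≤ Y) (hZ : 0 ≤ Z) (hr : 0 ≤ r) :
    (3 * (X + Y + Z)) ^ r ≤ 9 ^ r * (X ^ r + Y ^ r + Z ^ r) := by
  set m := max (max X Y) Z with hm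
  have hXm : X ≤ m := (le_max_left _ _).trans (le_max_left _ _)
  have hYm : Y ≤ m := (le_max_right _ _).trans (le_max_left _ _)
  have hZm : Z ≤ m := le_max_right _ _
  have h1 : m ^ r ≤ X ^ r + Y ^ r + Z ^ r := by
    have h2 := Real.rpow_nonneg hX r
    have h3 := Real.rpow_nonneg hY r
    have h4 := Real.rpow_nonneg hZ r
    rcases max_choice (max X Y) Z with h | h
    · rcases max_choice X Y with h' | h' <;> rw [hm, h, h'] <;> linarith
    · rw [hm, h]; linarith
  calc (3 * (X + Y + Z)) ^ r ≤ (9 * m) ^ r :=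
        Real.rpow_le_rpow (by positivity) (by linarith) hr
    _ = 9 ^ r * m ^ r := Real.mul_rpow (by norm_num) (hX.trans hXm)
    _ ≤ _ := by gcongr

/-- Rubio de Francia's inequality on the finite group, for exponents `Q ≥ 2`. -/
lemma exists_interval_square {Q : ℝ} (hQ : 2 ≤ Q) (M : ℕ) :
    ∃ C : ℝ, 0 ≤ C ∧ ∀ (q : ℕ → ℕ) [∀ i, NeZero (q i)] (_ : ∀ i, q i ≤ M) (N : ℕ) (_ : 0 < N)
      (T : Type*) [Fintype T] (a b : T → ℕ) (c : ℕ → ℂ),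
      (∀ t, a t ≤ b t) → (∀ t, b t < radix q N) →
      (∀ n t t', n ∈ Finset.Ico (a t) (b t) → n ∈ Finset.Ico (a t') (b t') → t = t') →
      ∑ x : Digits q N, (∑ t, ‖poly c (Finset.Ico (a t) (b t)) x‖ ^ 2) ^ (Q / 2) ≤
        C * ∑ x : Digits q N, ‖poly c (Finset.range (radix q N)) x‖ ^ Q := by
  classical
  obtain ⟨C₁, hC₁0, hC₁⟩ := exists_block_square (r := Q / 2) (by linarith)
  obtain ⟨C₂, hC₂0, hC₂⟩ := exists_modulated_square hQ M
  refine ⟨9 ^ (Q / 2) * (C₁ + C₂ + C₂), by positivity, ?_⟩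
  intro q _ hM N hN T _ a b c hab hb hdisj
  set P : T → Digits q N → ℂ := fun t x => poly c ((Finset.Ico (a t) (b t)).filter (· = a t)) x
    with hP
  set L : T → Digits q N → ℂ := fun t x =>
    ∑ k ∈ Finset.range N, poly c (blocks q N k (leftBlocks q (a t) (b t) k)) x with hL
  set R : T → Digits q N → ℂ := fun t x =>
    ∑ k ∈ Finset.range N, poly c (blocks q N k (rightBlocks q (a t) (b t) k)) x with hR
  have hLsum := hC₂ q hM N T a (fun t k => leftBlocks q (a t) (b t) k) c
    (fun t => (hab t).trans_lt (hb t))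
    (fun t k j hj => by
      simp only [leftBlocks, Finset.mem_filter, Finset.mem_Ioo] at hj
      exact ⟨hj.1.1.ne', hj.2⟩)
    (fun n t t' k k' h h' => by
      have h1 := (mem_leftBlocks.1 h).1
      have h2 := (mem_leftBlocks.1 h').1
      obtain rfl := hdisj n t t'
        (Finset.mem_Ico.2 ⟨(lt_of_div_radix_lt h1.1).le, lt_of_div_radix_lt h1.2⟩)
        (Finset.mem_Ico.2 ⟨(lt_of_div_radix_lt h2.1).le, lt_of_div_radix_lt h2.2⟩)
      exact ⟨rfl, leftBlocks_unique h h'⟩)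
  have hRsum := hC₂ q hM N T b (fun t k => rightBlocks q (a t) (b t) k) c hb
    (fun t k j hj => by
      simp only [rightBlocks, Finset.mem_filter, Finset.mem_Ioo] at hj
      exact ⟨hj.1.2.ne, hj.2.1⟩)
    (fun n t t' k k' h h' => by
      have h1 := (mem_rightBlocks.1 h).1
      have h2 := (mem_rightBlocks.1 h').1
      obtain rfl := hdisj n t t'
        (Finset.mem_Ico.2 ⟨(lt_of_div_radix_lt h1.1).le, lt_of_div_radix_lt h1.2⟩)
        (Finset.mem_Ico.2 ⟨(lt_of_div_radix_lt h2.1).le, lt_of_div_radix_lt h2.2⟩)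
      exact ⟨rfl, rightBlocks_unique h h'⟩)
  have hPsum : ∑ x, (∑ t, ‖P t x‖ ^ 2) ^ (Q / 2) ≤
      C₁ * ∑ x : Digits q N, ‖poly c (Finset.range (radix q N)) x‖ ^ Q := by
    set J : ℕ → Finset ℕ := fun k =>
      if k = 0 then (Finset.univ.filter fun t => a t < b t).image a else ∅ with hJ
    have hJ0 : ∀ k n, n ∈ J k → k = 0 := by
      intro k n hn
      by_contra hk
      simp [hJ, hk] at hn
    have h := hC₁ q N J c fun n k k' hk hk' => (hJ0 k _ hk).trans (hJ0 k' _ hk').symm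
    simp only [norm_sq_rpow_div_two] at h
    refine le_trans (Finset.sum_le_sum fun x _ => ?_) h
    refine Real.rpow_le_rpow (by positivity) ?_ (by linarith)
    refine le_trans ?_ (Finset.single_le_sum (f := fun k =>
      ∑ j ∈ J k, ‖poly c (blocks q N k {j}) x‖ ^ 2) (fun k _ => by positivity)
      (Finset.mem_range.2 hN))
    simp only [hJ, if_true]
    rw [Finset.sum_image, ← Finset.sum_subset (Finset.filter_subset (fun t => a t < b t) _)]
    · refine Finset.sum_le_sum fun t ht => ?_
      have hset : (Finset.Ico (a t) (b t)).filter (· = a t) = blocks q N 0 {a t} := by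
        ext n
        simp only [Finset.mem_filter, Finset.mem_univ, true_and] at ht
        simp only [Finset.mem_filter, Finset.mem_Ico, mem_blocks, radix, Finset.range_zero,
          Finset.prod_empty, Nat.div_one, Finset.mem_singleton]
        constructor
        · rintro ⟨h1, h2⟩; exact ⟨h1.2.trans (hb t), h2⟩
        · rintro ⟨h1, rfl⟩; exact ⟨⟨le_rfl, ht⟩, rfl⟩
      simp only [hP, hset, le_refl]
    · intro t _ ht
      have : ¬ a t < b t := fun h => ht (by simp [h])
      simp [hP, Finset.Ico_eq_empty this, poly]
    · intro t ht t' ht' haa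
      simp only [Finset.coe_filter, Finset.mem_univ, true_and, Set.mem_ofPred_eq] at ht ht'
      exact hdisj (a t) t t' (Finset.mem_Ico.2 ⟨le_rfl, ht⟩)
        (Finset.mem_Ico.2 ⟨haa.ge, haa ▸ ht'⟩)
  have hpt : ∀ x, (∑ t, ‖poly c (Finset.Ico (a t) (b t)) x‖ ^ 2) ^ (Q / 2) ≤
      9 ^ (Q / 2) * ((∑ t, ‖P t x‖ ^ 2) ^ (Q / 2) + (∑ t, ‖L t x‖ ^ 2) ^ (Q / 2) +
        (∑ t, ‖R t x‖ ^ 2) ^ (Q / 2)) := by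
    intro x
    refine le_trans (Real.rpow_le_rpow (by positivity) ?_ (by linarith))
      (three_mul_add_rpow_le (by positivity) (by positivity) (by positivity) (by linarith))
    rw [← Finset.sum_add_distrib, ← Finset.sum_add_distrib, Finset.mul_sum]
    refine Finset.sum_le_sum fun t _ => ?_
    rw [poly_Ico (hb t)]
    have h3 : ‖P t x + L t x + R t x‖ ≤ ‖P t x‖ + ‖L t x‖ + ‖R t x‖ := norm_add₃_le
    calc ‖P t x + L t x + R t x‖ ^ 2 ≤ (‖P t x‖ + ‖L t x‖ + ‖R t x‖) ^ 2 := by gcongr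
      _ ≤ _ := by
        nlinarith [sq_nonneg (‖P t x‖ - ‖L t x‖), sq_nonneg (‖P t x‖ - ‖R t x‖),
          sq_nonneg (‖L t x‖ - ‖R t x‖)]
  refine (Finset.sum_le_sum fun x _ => hpt x).trans ?_
  rw [← Finset.mul_sum, Finset.sum_add_distrib, Finset.sum_add_distrib, mul_assoc]
  refine mul_le_mul_of_nonneg_left ?_ (by positivity)
  rw [add_mul, add_mul]
  exact add_le_add (add_le_add hPsum hLsum) hRsum

/-- The theorem for finitely many polynomials on the finite group, by duality: the sum `F` is
paired with `‖F‖ ^ (p - 2) F`, whose pieces are controlled in the conjugate exponent. -/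
lemma exists_finite_rubio_de_francia {p : ℝ} (hp1 : 1 < p) (hp2 : p ≤ 2) (M : ℕ) :
    ∃ C : ℝ, 0 ≤ C ∧ ∀ (q : ℕ → ℕ) [∀ i, NeZero (q i)] (_ : ∀ i, q i ≤ M) (N : ℕ) (_ : 0 < N)
      (T : Type*) [Fintype T] (a b : T → ℕ) (c : T → ℕ → ℂ),
      (∀ t, a t ≤ b t) → (∀ t, b t < radix q N) →
      (∀ n t t', n ∈ Finset.Ico (a t) (b t) → n ∈ Finset.Ico (a t') (b t') → t = t') →
      ∑ x : Digits q N, ‖∑ t, poly (c t) (Finset.Ico (a t) (b t)) x‖ ^ p ≤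
        C * ∑ x : Digits q N, (∑ t, ‖poly (c t) (Finset.Ico (a t) (b t)) x‖ ^ 2) ^ (p / 2) := by
  set Q : ℝ := p / (p - 1) with hQ
  have hp0 : 0 < p - 1 := by linarith
  have hQ2 : 2 ≤ Q := by rw [hQ, le_div_iff₀ hp0]; linarith
  have hQ0 : 0 < Q := by linarith
  obtain ⟨K, hK0, hK⟩ := exists_interval_square hQ2 M
  obtain ⟨C, hC0, hC⟩ := exists_le_of_holder (α := 1 / Q) (K := K) (C := 1) (by positivity)
    (by rw [div_lt_one hQ0]; linarith) hK0 zero_le_one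
  refine ⟨C, hC0, ?_⟩
  intro q _ hM N hN T _ a b c hab hb hdisj
  set f : T → Digits q N → ℂ := fun t x => poly (c t) (Finset.Ico (a t) (b t)) x with hf
  set F : Digits q N → ℂ := fun x => ∑ t, f t x with hF
  set g : Digits q N → ℂ := fun x => ((‖F x‖ ^ (p - 2) : ℝ) : ℂ) * F x with hg
  obtain ⟨γ, hγ⟩ := exists_poly_eq g
  set G : T → Digits q N → ℂ := fun t x => poly γ (Finset.Ico (a t) (b t)) x with hG
  have hgQ : ∀ x, ‖g x‖ ^ Q = ‖F x‖ ^ p := by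
    intro x
    rcases (norm_nonneg (F x)).eq_or_lt with h | h
    · have h' : F x = 0 := norm_eq_zero.1 h.symm
      simp [hg, h', Real.zero_rpow hQ0.ne', Real.zero_rpow (by linarith : p ≠ 0)]
    · simp only [hg]
      rw [norm_mul, Complex.norm_real, Real.norm_of_nonneg (Real.rpow_nonneg h.le _),
        ← Real.rpow_add_one h.ne', ← Real.rpow_mul h.le]
      congr 1
      rw [hQ]; field_simp; ring
  have hFg : ∀ x, ((‖F x‖ ^ p : ℝ) : ℂ) = F x * (starRingEnd ℂ) (g x) := by
    intro x
    rcases (norm_nonneg (F x)).eq_or_lt with h | h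
    · have h' : F x = 0 := norm_eq_zero.1 h.symm
      simp [h', Real.zero_rpow (by linarith : p ≠ 0)]
    · simp only [hg, map_mul, Complex.conj_ofReal]
      rw [mul_left_comm, Complex.mul_conj, Complex.normSq_eq_norm_sq, ← Complex.ofReal_mul]
      congr 1
      rw [← Real.rpow_natCast, ← Real.rpow_add h]
      congr 1; push_cast; ring
  have hpair : ∀ t, ∑ x, f t x * (starRingEnd ℂ) (g x) = ∑ x, f t x * (starRingEnd ℂ) (G t x) := by
    intro t
    have hsub : Finset.Ico (a t) (b t) ⊆ Finset.range (radix q N) := fun n hn =>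
      Finset.mem_range.2 ((Finset.mem_Ico.1 hn).2.trans (hb t))
    have h0 := sum_mul_poly_eq_zero (q := q) (N := N) (k := 0) (c := c t) (c' := γ) hsub
      (Finset.sdiff_subset (s := Finset.range (radix q N)) (t := Finset.Ico (a t) (b t))) ?_
      (φ := fun _ => 1) (fun _ _ _ => rfl)
    · have h1 : ∀ x, f t x * (starRingEnd ℂ) (g x) = f t x * (starRingEnd ℂ) (G t x) +
          1 * (poly (c t) (Finset.Ico (a t) (b t)) x * (starRingEnd ℂ)
            (poly γ (Finset.range (radix q N) \ Finset.Ico (a t) (b t)) x)) := by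
        intro x
        rw [one_mul, ← mul_add, ← map_add, ← poly_union Finset.disjoint_sdiff,
          Finset.union_sdiff_of_subset hsub, hγ]
      simp only [h1, Finset.sum_add_distrib, h0, add_zero]
    · intro n hn n' hn' h
      simp only [radix, Finset.range_zero, Finset.prod_empty, Nat.div_one] at h
      exact (Finset.mem_sdiff.1 hn').2 (h ▸ hn)
  have hmain : ∑ x, ‖F x‖ ^ p ≤ ∑ x, (∑ t, ‖G t x‖ ^ 2) ^ (1 / 2 : ℝ) *
      (∑ t, ‖f t x‖ ^ 2) ^ (1 / 2 : ℝ) := by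
    have h1 : ((∑ x, ‖F x‖ ^ p : ℝ) : ℂ) = ∑ x, ∑ t, f t x * (starRingEnd ℂ) (G t x) := by
      rw [Complex.ofReal_sum, Finset.sum_congr rfl fun x _ => hFg x]
      simp only [hF, Finset.sum_mul]
      rw [Finset.sum_comm, Finset.sum_congr rfl fun t _ => hpair t, Finset.sum_comm]
    have h2 : ∑ x, ‖F x‖ ^ p = ‖((∑ x, ‖F x‖ ^ p : ℝ) : ℂ)‖ := by
      rw [Complex.norm_real, Real.norm_of_nonneg]
      exact Finset.sum_nonneg fun x _ => Real.rpow_nonneg (norm_nonneg _) _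
    rw [h2, h1]
    refine (norm_sum_le _ _).trans (Finset.sum_le_sum fun x _ => ?_)
    refine (norm_sum_le _ _).trans ?_
    rw [← Real.sqrt_eq_rpow, ← Real.sqrt_eq_rpow]
    refine le_trans (Finset.sum_le_sum fun t _ => ?_)
      (Real.sum_mul_le_sqrt_mul_sqrt Finset.univ (fun t => ‖G t x‖) fun t => ‖f t x‖)
    rw [norm_mul, RCLike.norm_conj, mul_comm]
  have hGs : ∑ x, (∑ t, ‖G t x‖ ^ 2) ^ (Q / 2) ≤ K * ∑ x, ‖F x‖ ^ p := by
    have := hK q hM N hN T a b γ hab hb hdisj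
    simpa only [hγ, hgQ] using this
  refine hC (fun x => (∑ t, ‖G t x‖ ^ 2) ^ (Q / 2)) (fun x => (∑ t, ‖f t x‖ ^ 2) ^ (p / 2)) _
    (fun x => by positivity) (fun x => by positivity) hGs ?_
  rw [one_mul]
  refine hmain.trans_eq (Finset.sum_congr rfl fun x _ => ?_)
  rw [← Real.rpow_mul (by positivity), ← Real.rpow_mul (by positivity)]
  congr 2
  · field_simp
  · rw [hQ]; field_simp; ring

/-! ### The digits of a point of the unit interval -/

/-- The first `N` digits of a real number. -/
noncomputable def digits (q : ℕ → ℕ) (N : ℕ) (x : ℝ) : Digits q N :=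
  fun i => ((⌊x * (radix q (i + 1) : ℝ)⌋₊ : ℕ) : ZMod (q i))

lemma measurable_digits (q : ℕ → ℕ) (N : ℕ) : Measurable (digits q N) := by
  refine measurable_pi_iff.2 fun i => ?_
  exact (measurable_of_countable (fun n : ℕ => (n : ZMod (q i)))).comp
    (Nat.measurable_floor.comp (measurable_id.mul_const _))

lemma self_lt_radix {q : ℕ → ℕ} (hq : ∀ i, 2 ≤ q i) (n : ℕ) : n < radix q n := by
  induction n with
  | zero => simp [radix]
  | succ n ih =>
    rw [radix_succ]
    nlinarith [hq n]

lemma radix_mono (q : ℕ → ℕ) [∀ i, NeZero (q i)] : Monotone (radix q) :=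
  monotone_nat_of_le_succ fun k => by
    rw [radix_succ]
    exact Nat.le_mul_of_pos_right _ (Nat.pos_of_ne_zero (NeZero.ne (q k)))

section Digits

variable {q : ℕ → ℕ} [∀ i, NeZero (q i)] {N : ℕ}

lemma floor_mul_radix (x : ℝ) (k : ℕ) :
    ⌊x * (radix q k : ℝ)⌋₊ = ⌊x * (radix q (k + 1) : ℝ)⌋₊ / q k := by
  have hqk : (q k : ℝ) ≠ 0 := Nat.cast_ne_zero.2 (NeZero.ne (q k))
  rw [← Nat.floor_div_natCast, radix_succ, Nat.cast_mul, ← mul_assoc, mul_div_cancel_right₀ _ hqk]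

/-- Two points of `[0, 1)` have the same first `N` digits if and only if they lie in the same cell
of length `1 / m_N`. -/
lemma digits_eq_iff {x y : ℝ} (hx : x < 1) (hy : y < 1) :
    digits q N x = digits q N y ↔ ⌊x * (radix q N : ℝ)⌋₊ = ⌊y * (radix q N : ℝ)⌋₊ := by
  constructor
  · intro h
    have key : ∀ k ≤ N, ⌊x * (radix q k : ℝ)⌋₊ = ⌊y * (radix q k : ℝ)⌋₊ := by
      intro k
      induction k with
      | zero =>
        intro _
        have hx' : ⌊x⌋₊ = 0 := Nat.floor_eq_zero.2 hx
        have hy' : ⌊y⌋₊ = 0 := Nat.floor_eq_zero.2 hy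
        simp [radix, hx', hy']
      | succ k ih =>
        intro hk
        have h1 := congrFun h ⟨k, hk⟩
        simp only [digits, ZMod.natCast_eq_natCast_iff'] at h1
        have h2 := ih (by omega)
        rw [floor_mul_radix x k, floor_mul_radix y k] at h2
        rw [← Nat.div_add_mod ⌊x * (radix q (k + 1) : ℝ)⌋₊ (q k), h1, h2, Nat.div_add_mod]
    exact key N le_rfl
  · intro h
    have key : ∀ k ≤ N, ⌊x * (radix q k : ℝ)⌋₊ = ⌊y * (radix q k : ℝ)⌋₊ := fun k hk =>
      Nat.decreasingInduction' (fun j _ _ ih => by rw [floor_mul_radix x, floor_mul_radix y, ih])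
        hk h
    funext i
    simp only [digits]
    rw [key (i + 1) i.2]

lemma unitMeasure_eq : unitMeasure = volume.restrict (Set.Ico 0 1) :=
  Measure.restrict_congr_set Ico_ae_eq_Icc.symm

instance : IsProbabilityMeasure unitMeasure := ⟨by simp [unitMeasure]⟩

lemma floor_mul_radix_eq_iff {x : ℝ} (hx : 0 ≤ x) (j : ℕ) :
    ⌊x * (radix q N : ℝ)⌋₊ = j ↔ x ∈ Set.Ico ((j : ℝ) / radix q N) ((j + 1) / radix q N) := by
  have hm : (0 : ℝ) < radix q N := Nat.cast_pos.2 (radix_pos q N)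
  rw [Nat.floor_eq_iff (by positivity), Set.mem_Ico, div_le_iff₀ hm, lt_div_iff₀ hm]

/-- The first `N` digits of a random point are uniformly distributed. -/
lemma map_digits_singleton (ω : Digits q N) :
    (unitMeasure.map (digits q N)) {ω} = (radix q N : ℝ≥0∞)⁻¹ := by
  have hm : (0 : ℝ) < radix q N := Nat.cast_pos.2 (radix_pos q N)
  have hlt : ∀ j : Fin (radix q N), (j : ℝ) / radix q N < 1 := fun j => by
    rw [div_lt_one hm]; exact_mod_cast j.2
  have hfl : ∀ j : ℕ, ⌊(j : ℝ) / radix q N * (radix q N : ℝ)⌋₊ = j := fun j => by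
    rw [div_mul_cancel₀ _ hm.ne', Nat.floor_natCast]
  have hinj : Function.Injective fun j : Fin (radix q N) => digits q N ((j : ℝ) / radix q N) := by
    intro j j' h
    have := (digits_eq_iff (hlt j) (hlt j')).1 h
    rw [hfl, hfl] at this
    exact Fin.ext this
  have hcard : Fintype.card (Fin (radix q N)) = Fintype.card (Digits q N) := by
    rw [Fintype.card_fin, Fintype.card_pi, radix]
    simp only [ZMod.card]
    exact (Fin.prod_univ_eq_prod_range q N).symm
  obtain ⟨j, rfl⟩ := ((Fintype.bijective_iff_injective_and_card _).2 ⟨hinj, hcard⟩).2 ω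
  have hset : digits q N ⁻¹' {digits q N ((j : ℝ) / radix q N)} ∩ Set.Ico 0 1 =
      Set.Ico ((j : ℝ) / radix q N) ((j + 1) / radix q N) := by
    ext x
    simp only [Set.mem_inter_iff, Set.mem_preimage, Set.mem_singleton_iff]
    constructor
    · rintro ⟨h, hx⟩
      have := (digits_eq_iff hx.2 (hlt j)).1 h
      rw [hfl] at this
      exact (floor_mul_radix_eq_iff hx.1 _).1 this
    · intro hx
      have hx0 : 0 ≤ x := le_trans (by positivity) hx.1
      have hx1 : x < 1 := hx.2.trans_le (by
        rw [div_le_one hm]; exact_mod_cast j.2)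
      refine ⟨(digits_eq_iff hx1 (hlt j)).2 ?_, hx0, hx1⟩
      rw [hfl]
      exact (floor_mul_radix_eq_iff hx0 _).2 hx
  rw [Measure.map_apply (measurable_digits q N) (measurableSet_singleton _), unitMeasure_eq,
    Measure.restrict_apply (measurable_digits q N (measurableSet_singleton _)), hset,
    Real.volume_Ico, ← sub_div, add_sub_cancel_left, one_div, ENNReal.ofReal_inv_of_pos hm, ENNReal.ofReal_natCast]

lemma lintegral_digits (h : Digits q N → ℝ≥0∞) :
    ∫⁻ x, h (digits q N x) ∂unitMeasure = (radix q N : ℝ≥0∞)⁻¹ * ∑ ω, h ω := by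
  rw [← lintegral_map (measurable_of_countable h) (measurable_digits q N), lintegral_fintype,
    Finset.mul_sum]
  simp only [map_digits_singleton, mul_comm]

lemma integral_digits (h : Digits q N → ℂ) :
    ∫ x, h (digits q N x) ∂unitMeasure = (radix q N : ℂ)⁻¹ * ∑ ω, h ω := by
  have : IsFiniteMeasure (unitMeasure.map (digits q N)) :=
    Measure.isFiniteMeasure_map _ _
  rw [← integral_map (measurable_digits q N).aemeasurable
    (measurable_of_countable h).aestronglyMeasurable, integral_fintype (Integrable.of_finite),
    Finset.mul_sum]
  refine Finset.sum_congr rfl fun ω _ => ?_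
  rw [measureReal_def, map_digits_singleton, ENNReal.toReal_inv, ENNReal.toReal_natCast,
    Complex.real_smul]
  push_cast
  rfl

lemma rademacher_pow_digit (k n : ℕ) (x : ℝ) :
    rademacher q k x ^ digit q n k = ZMod.stdAddChar
      (((⌊x * (radix q (k + 1) : ℝ)⌋₊ : ℕ) : ZMod (q k)) * ((n / radix q k : ℕ) : ZMod (q k))) := by
  have h1 : rademacher q k x =
      ZMod.stdAddChar (((⌊x * (radix q (k + 1) : ℝ)⌋₊ : ℕ) : ZMod (q k))) := by
    have := ZMod.stdAddChar_coe (N := q k) ((⌊x * (radix q (k + 1) : ℝ)⌋₊ % q k : ℕ) : ℤ)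
    rw [rademacher]
    simp only [Int.cast_natCast, ZMod.natCast_mod] at this
    rw [this]
  rw [h1, ← AddChar.map_nsmul_eq_pow, nsmul_eq_mul, mul_comm, digit, ZMod.natCast_mod]

/-- The Vilenkin function `w_n` is the corresponding character of the digits. The
product defining `w_n` has `n` factors instead of `N`; the additional ones are equal to `1`. -/
lemma vilenkin_eq_char (hq : ∀ i, 2 ≤ q i) {n : ℕ} (hn : n < radix q N) (x : ℝ) :
    vilenkin q n x = char q N n (digits q N x) := by
  have hprod : ∀ K L, n < radix q K → K ≤ L →
      ∏ k ∈ Finset.range L, rademacher q k x ^ digit q n k =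
        ∏ k ∈ Finset.range K, rademacher q k x ^ digit q n k := by
    intro K L hK hKL
    refine (Finset.prod_subset (Finset.range_subset_range.2 hKL) fun k _ hk => ?_).symm
    rw [Finset.mem_range, not_lt] at hk
    rw [digit, Nat.div_eq_of_lt (hK.trans_le (radix_mono q hk)), Nat.zero_mod, pow_zero]
  rw [vilenkin, ← hprod n (max n N) (self_lt_radix hq n) (le_max_left _ _),
    hprod N (max n N) hn (le_max_right _ _), char_apply,
    ← Fin.prod_univ_eq_prod_range (fun k => rademacher q k x ^ digit q n k)]
  exact Finset.prod_congr rfl fun i _ => rademacher_pow_digit _ _ _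

end Digits

section Coefficients

variable {q : ℕ → ℕ}

lemma neZero_of_two_le (hq : ∀ i, 2 ≤ q i) (i : ℕ) : NeZero (q i) := ⟨by have := hq i; omega⟩

lemma norm_vilenkin (hq : ∀ i, 2 ≤ q i) (n : ℕ) (x : ℝ) : ‖vilenkin q n x‖ = 1 := by
  have := neZero_of_two_le hq
  rw [vilenkin_eq_char hq (self_lt_radix hq n), AddChar.norm_apply]

lemma measurable_vilenkin (hq : ∀ i, 2 ≤ q i) (n : ℕ) : Measurable (vilenkin q n) := by
  have := neZero_of_two_le hq
  rw [show vilenkin q n = fun x => char q n n (digits q n x) from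
    funext fun x => vilenkin_eq_char hq (self_lt_radix hq n) x]
  exact (measurable_of_countable _).comp (measurable_digits q n)

lemma coeff_vilenkin (hq : ∀ i, 2 ≤ q i) (n n' : ℕ) :
    coeff q (vilenkin q n) n' = if n = n' then 1 else 0 := by
  have := neZero_of_two_le hq
  set N := max n n' with hN
  have hn : n < radix q N := (self_lt_radix hq n).trans_le (radix_mono q (le_max_left _ _))
  have hn' : n' < radix q N := (self_lt_radix hq n').trans_le (radix_mono q (le_max_right _ _))
  rw [coeff]
  simp only [vilenkin_eq_char hq hn, vilenkin_eq_char hq hn']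
  split_ifs with h
  · subst h
    simp [char_mul_conj_self]
  · rw [integral_digits (fun ω => char q N n ω * (starRingEnd ℂ) (char q N n' ω))]
    have h0 := sum_mul_char_eq_zero (k := 0) hn hn' (by simpa [radix] using h)
      (φ := fun _ => 1) (fun _ _ _ => rfl)
    simp only [one_mul] at h0
    rw [h0, mul_zero]

lemma integrable_mul_conj_vilenkin (hq : ∀ i, 2 ≤ q i) {f : ℝ → ℂ} (hf : Integrable f unitMeasure)
    (n : ℕ) : Integrable (fun x => f x * (starRingEnd ℂ) (vilenkin q n x)) unitMeasure :=
  hf.mul_bdd (c := 1) (Complex.continuous_conj.measurable.comp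
    (measurable_vilenkin hq n)).aestronglyMeasurable
    (Eventually.of_forall fun x => by rw [RCLike.norm_conj, norm_vilenkin hq])

lemma integrable_vilenkin (hq : ∀ i, 2 ≤ q i) (n : ℕ) : Integrable (vilenkin q n) unitMeasure :=
  Integrable.of_bound (measurable_vilenkin hq n).aestronglyMeasurable 1
    (Eventually.of_forall fun x => (norm_vilenkin hq n x).le)

/-- A function without Vilenkin coefficients is orthogonal to all functions of the first `N`
digits. -/
lemma integral_mul_digits_eq_zero (hq : ∀ i, 2 ≤ q i) [∀ i, NeZero (q i)] {f : ℝ → ℂ}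
    (hf : Integrable f unitMeasure) (h0 : ∀ n, coeff q f n = 0) (N : ℕ) (h : Digits q N → ℂ) :
    ∫ x, f x * h (digits q N x) ∂unitMeasure = 0 := by
  obtain ⟨c, hc⟩ := exists_poly_eq fun ω => (starRingEnd ℂ) (h ω)
  have h1 : ∀ x, f x * h (digits q N x) = ∑ n ∈ Finset.range (radix q N),
      (starRingEnd ℂ) (c n) * (f x * (starRingEnd ℂ) (vilenkin q n x)) := by
    intro x
    have h2 := congrArg (starRingEnd ℂ) (hc (digits q N x))
    rw [Complex.conj_conj, poly, map_sum] at h2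
    rw [← h2, Finset.mul_sum]
    refine Finset.sum_congr rfl fun n hn => ?_
    rw [vilenkin_eq_char hq (Finset.mem_range.1 hn), map_mul]
    ring
  simp only [h1]
  rw [integral_finsetSum _ fun n _ => (integrable_mul_conj_vilenkin hq hf n).const_mul _]
  refine Finset.sum_eq_zero fun n _ => ?_
  rw [integral_const_mul, ← coeff, h0, mul_zero]

/-- Completeness of the Vilenkin system in `L¹`: the primitive of `f` vanishes at the end points
of all cells, hence everywhere by continuity. -/
lemma ae_eq_zero_of_coeff_eq_zero (hq : ∀ i, 2 ≤ q i) {f : ℝ → ℂ} (hf : Integrable f unitMeasure)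
    (h0 : ∀ n, coeff q f n = 0) : f =ᵐ[unitMeasure] 0 := by
  classical
  have := neZero_of_two_le hq
  set g : ℝ → ℂ := (Set.Ico 0 1).indicator f with hg
  rw [unitMeasure_eq] at hf
  have hgint : Integrable g volume := (integrable_indicator_iff measurableSet_Ico).2 hf
  have hcont : Continuous fun t => ∫ y in (0 : ℝ)..t, g y :=
    intervalIntegral.continuous_primitive (fun a b => hgint.intervalIntegrable) 0
  have hcell : ∀ x ∈ Set.Ico (0 : ℝ) 1, ∀ N,
      ∫ y in (0 : ℝ)..(⌊x * (radix q N : ℝ)⌋₊ : ℝ) / radix q N, g y = 0 := by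
    intro x hx N
    have hm : (0 : ℝ) < radix q N := Nat.cast_pos.2 (radix_pos q N)
    set t : ℝ := (⌊x * (radix q N : ℝ)⌋₊ : ℝ) / radix q N with ht
    have ht0 : 0 ≤ t := by positivity
    have htx : t ≤ x := by
      rw [ht, div_le_iff₀ hm]
      exact Nat.floor_le (mul_nonneg hx.1 hm.le)
    have htm : t * radix q N = ⌊x * (radix q N : ℝ)⌋₊ := div_mul_cancel₀ _ hm.ne'
    have hmem : ∀ y ∈ Set.Ico (0 : ℝ) 1, digits q N y ∈ digits q N '' Set.Ico 0 t ↔ y < t := by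
      intro y hy
      constructor
      · rintro ⟨z, hz, hzy⟩
        have h1 := (digits_eq_iff (hz.2.trans_le (htx.trans hx.2.le)) hy.2).1 hzy
        have h2 : ⌊z * (radix q N : ℝ)⌋₊ < ⌊x * (radix q N : ℝ)⌋₊ := by
          rw [Nat.floor_lt (mul_nonneg hz.1 hm.le), ← htm]
          exact mul_lt_mul_of_pos_right hz.2 hm
        rw [h1, Nat.floor_lt (mul_nonneg hy.1 hm.le), ← htm] at h2
        exact lt_of_mul_lt_mul_right h2 hm.le
      · exact fun h => ⟨y, ⟨hy.1, h⟩, rfl⟩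
    have h1 := integral_mul_digits_eq_zero hq (unitMeasure_eq ▸ hf) h0 N
      (fun ω => if ω ∈ digits q N '' Set.Ico 0 t then 1 else 0)
    rw [unitMeasure_eq, ← integral_indicator measurableSet_Ico] at h1
    rw [intervalIntegral.integral_of_le ht0, setIntegral_congr_set Ico_ae_eq_Ioc.symm,
      ← integral_indicator measurableSet_Ico, ← h1]
    congr 1
    funext y
    by_cases hy : y ∈ Set.Ico (0 : ℝ) 1
    · by_cases hyt : y < t
      · have hy' : y ∈ Set.Ico 0 t := ⟨hy.1, hyt⟩
        simp [Set.indicator_of_mem hy', Set.indicator_of_mem hy, hg, (hmem y hy).2 hyt,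
          -Set.mem_image]
      · have hy' : y ∉ Set.Ico 0 t := fun h => hyt h.2
        have hy'' := fun h => hyt ((hmem y hy).1 h)
        rw [Set.indicator_of_notMem hy', Set.indicator_of_mem hy, if_neg hy'', mul_zero]
    · have hy' : y ∉ Set.Ico 0 t := fun h => hy ⟨h.1, h.2.trans_le (htx.trans hx.2.le)⟩
      rw [Set.indicator_of_notMem hy', Set.indicator_of_notMem hy]
  have hprim : ∀ x ∈ Set.Ico (0 : ℝ) 1, ∫ y in (0 : ℝ)..x, g y = 0 := by
    intro x hx
    have hrad : Tendsto (fun N => (radix q N : ℝ)) atTop atTop :=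
      tendsto_natCast_atTop_atTop.comp
        (tendsto_atTop_mono (fun n => (self_lt_radix hq n).le) tendsto_id)
    have hlim := (tendsto_nat_floor_mul_div_atTop hx.1).comp hrad
    have h1 := (hcont.tendsto x).comp hlim
    refine tendsto_nhds_unique h1 (tendsto_const_nhds.congr fun N => ?_)
    exact (hcell x hx N).symm
  rw [unitMeasure_eq, Measure.restrict_congr_set Ioo_ae_eq_Ico.symm]
  refine (ae_restrict_iff' measurableSet_Ioo).2 ?_
  filter_upwards [LocallyIntegrable.ae_hasDerivAt_integral hgint.locallyIntegrable] with x hx hx01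
  have h1 : (fun t => ∫ y in (0 : ℝ)..t, g y) =ᶠ[𝓝 x] fun _ => 0 := by
    filter_upwards [isOpen_Ioo.mem_nhds hx01] with t ht
    exact hprim t ⟨ht.1.le, ht.2⟩
  have h2 := (hx 0).unique ((hasDerivAt_const x (0 : ℂ)).congr_of_eventuallyEq h1)
  rwa [hg, Set.indicator_of_mem (Set.Ioo_subset_Ico_self hx01)] at h2

/-- An integrable function whose spectrum lies in `[a, b)` is a Vilenkin polynomial. -/
lemma ae_eq_sum_of_support_coeff (hq : ∀ i, 2 ≤ q i) {f : ℝ → ℂ} (hf : Integrable f unitMeasure)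
    {a b : ℕ} (hsupp : Function.support (coeff q f) ⊆ Set.Ico a b) :
    f =ᵐ[unitMeasure] fun x => ∑ n ∈ Finset.Ico a b, coeff q f n * vilenkin q n x := by
  have hint : Integrable (fun x => ∑ n ∈ Finset.Ico a b, coeff q f n * vilenkin q n x)
      unitMeasure := integrable_finsetSum _ fun n _ => (integrable_vilenkin hq n).const_mul _
  refine (sub_ae_eq_zero _ _).1 (ae_eq_zero_of_coeff_eq_zero hq (hf.sub hint) fun m => ?_)
  have h1 : coeff q (fun x => ∑ n ∈ Finset.Ico a b, coeff q f n * vilenkin q n x) m =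
      coeff q f m := by
    rw [coeff]
    simp only [Finset.sum_mul, mul_assoc]
    rw [integral_finsetSum _ fun n _ =>
      (integrable_mul_conj_vilenkin hq (integrable_vilenkin hq n) m).const_mul _]
    have hv : ∀ n, ∫ x, vilenkin q n x * (starRingEnd ℂ) (vilenkin q m x) ∂unitMeasure =
        if n = m then 1 else 0 := fun n => coeff_vilenkin hq n m
    simp only [integral_const_mul, hv, mul_ite, mul_one, mul_zero, Finset.sum_ite_eq']
    split_ifs with h
    · rfl
    · by_contra hne
      exact h (by simpa using hsupp (Ne.symm hne))
  have h2 : coeff q (f - fun x => ∑ n ∈ Finset.Ico a b, coeff q f n * vilenkin q n x) m =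
      coeff q f m - coeff q (fun x => ∑ n ∈ Finset.Ico a b, coeff q f n * vilenkin q n x) m := by
    simp only [coeff, Pi.sub_apply, sub_mul]
    exact integral_sub (integrable_mul_conj_vilenkin hq hf m)
      (integrable_mul_conj_vilenkin hq hint m)
  rw [h2, h1, sub_self]

end Coefficients

/-! ### From finite to countable families -/

lemma enorm_sq_eq_ofReal (z : ℂ) : ‖z‖ₑ ^ 2 = ENNReal.ofReal (‖z‖ ^ 2) := by
  rw [ENNReal.ofReal_pow (norm_nonneg z), ofReal_norm]

/-- The inequality for finitely many Vilenkin polynomials on the unit interval. -/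
lemma exists_lintegral_le (q : ℕ → ℕ) (hq : ∀ i, 2 ≤ q i) (M : ℕ) (hM : ∀ i, q i ≤ M)
    (p : ℝ) (hp1 : 1 < p) (hp2 : p ≤ 2) :
    ∃ K : ℝ, 0 ≤ K ∧ ∀ (ι : Type*) (a b : ι → ℕ) (c : ι → ℕ → ℂ) (S : Finset ι),
      (Pairwise fun s t => Disjoint (Set.Ico (a s) (b s)) (Set.Ico (a t) (b t))) →
      ∫⁻ x, ‖∑ s ∈ S, ∑ n ∈ Finset.Ico (a s) (b s), c s n * vilenkin q n x‖ₑ ^ p ∂unitMeasure ≤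
        ENNReal.ofReal K * ∫⁻ x, (∑ s ∈ S,
          ‖∑ n ∈ Finset.Ico (a s) (b s), c s n * vilenkin q n x‖ₑ ^ 2) ^ (p / 2) ∂unitMeasure := by
  have := neZero_of_two_le hq
  obtain ⟨K, hK0, hK⟩ := exists_finite_rubio_de_francia hp1 hp2 M
  refine ⟨K, hK0, fun ι a b c S hdisj => ?_⟩
  set N : ℕ := S.sup b + 1 with hN
  have hbN : ∀ s ∈ S, b s < radix q N := fun s hs =>
    (Finset.le_sup hs).trans_lt ((Nat.lt_succ_self _).trans (self_lt_radix hq N))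
  -- Empty intervals may have `b s < a s`; replacing `a s` by `min (a s) (b s)` is harmless.
  have hIco : ∀ s, Finset.Ico (min (a s) (b s)) (b s) = Finset.Ico (a s) (b s) := by
    intro s
    rcases le_total (a s) (b s) with h | h
    · rw [min_eq_left h]
    · rw [min_eq_right h, Finset.Ico_self, Finset.Ico_eq_empty (not_lt.2 h)]
  have hfin := hK q hM N (Nat.succ_pos _) S (fun s => min (a s) (b s)) (fun s => b s)
    (fun s => c s) (fun s => min_le_right _ _) (fun s => hbN s s.2) (fun n s t hs ht => by
      rw [hIco, ← Finset.mem_coe, Finset.coe_Ico] at hs ht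
      by_contra hne
      exact Set.disjoint_left.1 (hdisj fun h => hne (Subtype.ext h)) hs ht)
  simp only [hIco] at hfin
  have hpoly : ∀ s ∈ S, ∀ x, ∑ n ∈ Finset.Ico (a s) (b s), c s n * vilenkin q n x =
      poly (c s) (Finset.Ico (a s) (b s)) (digits q N x) := by
    intro s hs x
    refine Finset.sum_congr rfl fun n hn => ?_
    rw [vilenkin_eq_char hq ((Finset.mem_Ico.1 hn).2.trans (hbN s hs))]
  have hL : ∀ x, ‖∑ s ∈ S, ∑ n ∈ Finset.Ico (a s) (b s), c s n * vilenkin q n x‖ₑ ^ p =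
      ENNReal.ofReal (‖∑ s : S, poly (c s) (Finset.Ico (a s) (b s)) (digits q N x)‖ ^ p) := by
    intro x
    rw [Finset.sum_congr rfl fun s hs => hpoly s hs x, ← Finset.sum_coe_sort S,
      ← ENNReal.ofReal_rpow_of_nonneg (norm_nonneg _) (by linarith), ofReal_norm]
  have hR : ∀ x, (∑ s ∈ S, ‖∑ n ∈ Finset.Ico (a s) (b s), c s n * vilenkin q n x‖ₑ ^ 2) ^ (p / 2) =
      ENNReal.ofReal ((∑ s : S,
        ‖poly (c s) (Finset.Ico (a s) (b s)) (digits q N x)‖ ^ 2) ^ (p / 2)) := by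
    intro x
    rw [Finset.sum_congr rfl fun s hs => by rw [hpoly s hs x, enorm_sq_eq_ofReal],
      ← Finset.sum_coe_sort S, ← ENNReal.ofReal_sum_of_nonneg fun s _ => by positivity,
      ENNReal.ofReal_rpow_of_nonneg (by positivity) (by linarith)]
  simp only [hL, hR]
  rw [lintegral_digits (fun ω => ENNReal.ofReal
      (‖∑ s : S, poly (c s) (Finset.Ico (a s) (b s)) ω‖ ^ p)),
    lintegral_digits (fun ω => ENNReal.ofReal ((∑ s : S,
      ‖poly (c s) (Finset.Ico (a s) (b s)) ω‖ ^ 2) ^ (p / 2))),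
    mul_left_comm, ← ENNReal.ofReal_sum_of_nonneg fun ω _ => by positivity,
    ← ENNReal.ofReal_sum_of_nonneg fun ω _ => by positivity, ← ENNReal.ofReal_mul hK0]
  gcongr

lemma squareFunction_rpow {ι : Type*} (f : ι → ℝ → ℂ) (x : ℝ) (p : ℝ) :
    squareFunction f x ^ p = (∑' s, ‖f s x‖ₑ ^ 2) ^ (p / 2) := by
  rw [squareFunction, ← ENNReal.rpow_mul]
  congr 1; ring

lemma eLpNorm_ofReal_eq {E : Type*} [ENorm E] {μ : Measure ℝ} {p : ℝ} (hp : 0 < p) (f : ℝ → E) :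
    eLpNorm f (ENNReal.ofReal p) μ = (∫⁻ x, ‖f x‖ₑ ^ p ∂μ) ^ (1 / p) := by
  rw [eLpNorm_eq_lintegral_rpow_enorm_toReal (by simpa using hp) ENNReal.ofReal_ne_top,
    ENNReal.toReal_ofReal hp.le]

lemma eLpNorm_squareFunction {ι : Type*} {μ : Measure ℝ} {p : ℝ} (hp : 0 < p) (f : ι → ℝ → ℂ) :
    eLpNorm (squareFunction f) (ENNReal.ofReal p) μ =
      (∫⁻ x, (∑' s, ‖f s x‖ₑ ^ 2) ^ (p / 2) ∂μ) ^ (1 / p) := by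
  rw [eLpNorm_ofReal_eq hp]
  simp only [enorm_eq_self, squareFunction_rpow]

lemma enorm_le_squareFunction {ι : Type*} (f : ι → ℝ → ℂ) (s : ι) (x : ℝ) :
    ‖f s x‖ₑ ≤ squareFunction f x := by
  calc ‖f s x‖ₑ = (‖f s x‖ₑ ^ 2) ^ (1 / 2 : ℝ) := by
        rw [← ENNReal.rpow_natCast, ← ENNReal.rpow_mul]; norm_num
    _ ≤ squareFunction f x := by
        unfold squareFunction
        gcongr
        exact ENNReal.le_tsum s

/-- If the inequality holds for finite subfamilies and the square function of the whole family is
in `L ^ p`, the series converges unconditionally: by dominated convergence the square functions of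
the tails tend to zero in `L ^ p`. -/
lemma exists_tendsto_of_finite {ι : Type*} [Countable ι] {μ : Measure ℝ} {p : ℝ} (hp : 1 ≤ p)
    {C : ℝ≥0} (f : ι → ℝ → ℂ) (hf : ∀ s, Measurable (f s))
    (hfin : ∀ S : Finset ι, eLpNorm (fun x => ∑ s ∈ S, f s x) (ENNReal.ofReal p) μ ≤
      C * (∫⁻ x, (∑ s ∈ S, ‖f s x‖ₑ ^ 2) ^ (p / 2) ∂μ) ^ (1 / p))
    (hsq : eLpNorm (squareFunction f) (ENNReal.ofReal p) μ ≠ ∞) :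
    ∃ F : ℝ → ℂ, MemLp F (ENNReal.ofReal p) μ ∧
      Tendsto (fun S : Finset ι => eLpNorm (fun x => (∑ s ∈ S, f s x) - F x)
        (ENNReal.ofReal p) μ) atTop (𝓝 0) ∧
      eLpNorm F (ENNReal.ofReal p) μ ≤ C * eLpNorm (squareFunction f) (ENNReal.ofReal p) μ := by
  classical
  have hp0 : 0 < p := by linarith
  have hfact : Fact (1 ≤ ENNReal.ofReal p) := ⟨by simpa using hp⟩
  have hmem : ∀ s, MemLp (f s) (ENNReal.ofReal p) μ := fun s =>
    ⟨(hf s).aestronglyMeasurable,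
      (eLpNorm_mono_enorm fun x => enorm_le_squareFunction f s x).trans_lt hsq.lt_top⟩
  have hmemS : ∀ S : Finset ι, MemLp (fun x => ∑ s ∈ S, f s x) (ENNReal.ofReal p) μ := fun S =>
    memLp_finsetSum S fun s _ => hmem s
  have hsum : ∀ S : Finset ι, ∑ s ∈ S, (hmem s).toLp (f s) = (hmemS S).toLp _ := by
    intro S
    induction S using Finset.induction_on with
    | empty => simp only [Finset.sum_empty]; rfl
    | insert s S hs ih =>
      rw [Finset.sum_insert hs, ih, ← MemLp.toLp_add]
      congr 1
      funext x
      simp [Finset.sum_insert hs]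
  have hle : ∀ S : Finset ι, eLpNorm (fun x => ∑ s ∈ S, f s x) (ENNReal.ofReal p) μ ≤
      C * eLpNorm (squareFunction f) (ENNReal.ofReal p) μ := by
    intro S
    refine (hfin S).trans ?_
    rw [eLpNorm_squareFunction hp0]
    gcongr
    exact ENNReal.sum_le_tsum S
  rw [eLpNorm_squareFunction hp0] at hsq
  have hint : ∫⁻ x, (∑' s, ‖f s x‖ₑ ^ 2) ^ (p / 2) ∂μ ≠ ∞ := fun h => hsq (by
    rw [h, ENNReal.top_rpow_of_pos (by positivity)])
  set tail : Finset ι → ℝ → ℝ≥0∞ := fun S x => ∑' s : {s // s ∉ S}, ‖f s x‖ₑ ^ 2 with htail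
  have htail_meas : ∀ S, Measurable (tail S) := fun S =>
    Measurable.tsum fun s => (hf s).enorm.pow_const 2
  have htail_lim : Tendsto (fun S => ∫⁻ x, tail S x ^ (p / 2) ∂μ) atTop (𝓝 0) := by
    have hfull_meas : Measurable fun x => (∑' s, ‖f s x‖ₑ ^ 2) ^ (p / 2) :=
      (Measurable.tsum fun s => (hf s).enorm.pow_const 2).pow_const _
    have := tendsto_lintegral_filter_of_dominated_convergence (l := atTop) (μ := μ)
      (F := fun S x => tail S x ^ (p / 2)) (f := fun _ => 0)
      (fun x => (∑' s, ‖f s x‖ₑ ^ 2) ^ (p / 2))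
      (Eventually.of_forall fun S => (htail_meas S).pow_const _)
      (Eventually.of_forall fun S => Eventually.of_forall fun x => by
        gcongr
        exact ENNReal.tsum_comp_le_tsum_of_injective Subtype.val_injective _)
      hint ?_
    · simpa using this
    · filter_upwards [ae_lt_top hfull_meas hint] with x hx
      have hx' : ∑' s, ‖f s x‖ₑ ^ 2 ≠ ∞ := fun h => hx.ne (by
        rw [h, ENNReal.top_rpow_of_pos (by positivity)])
      have h1 := (ENNReal.tendsto_tsum_compl_atTop_zero hx').ennrpow_const (p / 2)
      rwa [ENNReal.zero_rpow_of_pos (by positivity)] at h1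
  have htail_lim' : Tendsto (fun S => (C : ℝ≥0∞) * (∫⁻ x, tail S x ^ (p / 2) ∂μ) ^ (1 / p))
      atTop (𝓝 0) := by
    have h1 := htail_lim.ennrpow_const (1 / p)
    rw [ENNReal.zero_rpow_of_pos (by positivity)] at h1
    simpa using ENNReal.Tendsto.const_mul h1 (Or.inr ENNReal.coe_ne_top)
  have hsummable : Summable fun s => (hmem s).toLp (f s) := by
    rw [summable_iff_vanishing_norm]
    intro ε hε
    obtain ⟨S, hS⟩ := (htail_lim'.eventually (gt_mem_nhds (ENNReal.ofReal_pos.2 hε))).exists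
    refine ⟨S, fun T hT => ?_⟩
    rw [hsum, Lp.norm_toLp]
    refine (ENNReal.toReal_lt_toReal (hmemS T).eLpNorm_ne_top ENNReal.ofReal_ne_top).2
      (lt_of_le_of_lt ?_ hS) |>.trans_eq (ENNReal.toReal_ofReal hε.le)
    refine (hfin T).trans ?_
    gcongr with x
    have h1 : ∑ s ∈ T, ‖f s x‖ₑ ^ 2 =
        ∑ s ∈ T.subtype (· ∉ S), ‖f (s : ι) x‖ₑ ^ 2 := by
      rw [Finset.sum_subtype_of_mem (fun s => ‖f s x‖ₑ ^ 2)
        fun s hs => Finset.disjoint_left.1 hT hs]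
    rw [h1]
    exact ENNReal.sum_le_tsum _
  obtain ⟨F, hF⟩ := hsummable
  have hFlim : Tendsto (fun S : Finset ι => (hmemS S).toLp _) atTop (𝓝 F) := by
    have : Tendsto (fun S : Finset ι => ∑ s ∈ S, (hmem s).toLp (f s)) atTop (𝓝 F) := hF
    simpa only [hsum] using this
  refine ⟨F, Lp.memLp F, ?_, ?_⟩
  · rw [Lp.tendsto_Lp_iff_tendsto_eLpNorm'] at hFlim
    refine hFlim.congr fun S => eLpNorm_congr_ae ?_
    filter_upwards [(hmemS S).coeFn_toLp] with x hx
    rw [Pi.sub_apply, hx]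
  · have hfinite : (C : ℝ≥0∞) * eLpNorm (squareFunction f) (ENNReal.ofReal p) μ ≠ ∞ :=
      ENNReal.mul_ne_top ENNReal.coe_ne_top (by rwa [eLpNorm_squareFunction hp0])
    have h1 : ‖F‖ ≤ ((C : ℝ≥0∞) * eLpNorm (squareFunction f) (ENNReal.ofReal p) μ).toReal :=
      le_of_tendsto hFlim.norm (Eventually.of_forall fun S => by
        rw [Lp.norm_toLp]
        exact ENNReal.toReal_mono hfinite (hle S))
    rw [Lp.norm_def] at h1
    exact (ENNReal.toReal_le_toReal (Lp.eLpNorm_ne_top F) hfinite).1 h1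

end Vilenkin

theorem theorem1 (q : ℕ → ℕ) (hq : ∀ i, 2 ≤ q i) (M : ℕ) (hM : ∀ i, q i ≤ M)
    (p : ℝ) (hp1 : 1 < p) (hp2 : p ≤ 2) :
    ∃ C : ℝ≥0, 0 < C ∧
      ∀ (ι : Type*) [Countable ι] (a b : ι → ℕ) (f : ι → ℝ → ℂ),
        (Pairwise fun s t => Disjoint (Set.Ico (a s) (b s)) (Set.Ico (a t) (b t))) →
        (∀ s, Integrable (f s) Vilenkin.unitMeasure) →
        (∀ s, Function.support (Vilenkin.coeff q (f s)) ⊆ Set.Ico (a s) (b s)) →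
        eLpNorm (Vilenkin.squareFunction f) (ENNReal.ofReal p) Vilenkin.unitMeasure ≠ ∞ →
        ∃ F : ℝ → ℂ, MemLp F (ENNReal.ofReal p) Vilenkin.unitMeasure ∧
          Tendsto
            (fun S : Finset ι => eLpNorm (fun x => (∑ s ∈ S, f s x) - F x)
              (ENNReal.ofReal p) Vilenkin.unitMeasure)
            atTop (𝓝 0) ∧
          eLpNorm F (ENNReal.ofReal p) Vilenkin.unitMeasure ≤
            C * eLpNorm (Vilenkin.squareFunction f) (ENNReal.ofReal p) Vilenkin.unitMeasure := by
  have hp0 : 0 < p := by linarith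
  obtain ⟨K, hK0, hK⟩ := Vilenkin.exists_lintegral_le q hq M hM p hp1 hp2
  refine ⟨(K.toNNReal + 1) ^ (1 / p), by positivity, ?_⟩
  intro ι _ a b f hdisj hint hsupp hsq
  set g : ι → ℝ → ℂ := fun s x =>
    ∑ n ∈ Finset.Ico (a s) (b s), Vilenkin.coeff q (f s) n * Vilenkin.vilenkin q n x with hg
  have hfg : ∀ᵐ x ∂Vilenkin.unitMeasure, ∀ s, f s x = g s x :=
    ae_all_iff.2 fun s => Vilenkin.ae_eq_sum_of_support_coeff hq (hint s) (hsupp s)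
  have hsqfg : eLpNorm (Vilenkin.squareFunction f) (ENNReal.ofReal p) Vilenkin.unitMeasure =
      eLpNorm (Vilenkin.squareFunction g) (ENNReal.ofReal p) Vilenkin.unitMeasure := by
    refine eLpNorm_congr_enorm_ae ?_
    filter_upwards [hfg] with x hx
    simp only [Vilenkin.squareFunction, hx]
  rw [hsqfg] at hsq ⊢
  have hfin : ∀ S : Finset ι,
      eLpNorm (fun x => ∑ s ∈ S, g s x) (ENNReal.ofReal p) Vilenkin.unitMeasure ≤
        ((K.toNNReal + 1) ^ (1 / p) : ℝ≥0) *
          (∫⁻ x, (∑ s ∈ S, ‖g s x‖ₑ ^ 2) ^ (p / 2) ∂Vilenkin.unitMeasure) ^ (1 / p) := by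
    intro S
    rw [Vilenkin.eLpNorm_ofReal_eq hp0, ENNReal.coe_rpow_of_nonneg _ (by positivity),
      ← ENNReal.mul_rpow_of_nonneg _ _ (by positivity)]
    refine ENNReal.rpow_le_rpow ((hK ι a b _ S hdisj).trans ?_) (by positivity)
    gcongr
    rw [ENNReal.ofReal]
    exact_mod_cast le_self_add
  obtain ⟨F, hF, hlim, hle⟩ := Vilenkin.exists_tendsto_of_finite hp1.le g
    (fun s => Finset.measurable_sum _ fun n _ =>
      (Vilenkin.measurable_vilenkin hq n).const_mul _) hfin hsq
  refine ⟨F, hF, hlim.congr fun S => eLpNorm_congr_ae ?_, hle⟩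
  filter_upwards [hfg] with x hx
  simp only [hx]
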